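/- For $n\ge 0$ let $B_n$ be the $n$-th Bell number (the number of set partitions of an $n$-element set), let $\alpha_n>0$ be the positive real solution of $ue^u=n+1$, and for an integer $k$ put $$\zeta_{n,k}:=e^{\alpha_n}\Bigl(1+\frac1{\alpha_n}\Bigr)+\frac{k}{\alpha_n^2}=\frac{(n+1)(\alpha_n+1)+k}{\alpha_n^2}.$$ Fix an integer $k$; all statements are for $n\to\infty$ (so that $n+k\ge0$), with implied constants depending only on $k$ (and on $T$ in part 2). 1. $$B_{n+k}=\frac{(n+k)!}{\sqrt{2\pi}\,e}\,\zeta_{n,k}^{-1/2}\exp\bigl(e^{\alpha_n}-(n+k+1)\log\alpha_n\bigr)\bigl(1+O(e^{-\alpha_n})\bigr).$$ 2. More precisely, there are rational functions $R_{m,k}(u)$ with rational coefficients ($m\ge1$, $k\in\mathbb Z$) such that for every integer $T\ge0$ $$B_{n+k}=\frac{(n+k)!}{\sqrt{2\pi}\,e}\,\zeta_{n,k}^{-1/2}\exp\bigl(e^{\alpha_n}-(n+k+1)\log\alpha_n\bigr)\Bigl(1+\sum_{m=1}^{T}R_{m,k}(\alpha_n)\frac1{n^m}+O\Bigl(\Bigl(\frac{\alpha_n}{n}\Bigr)^{T+1}\Bigr)\Bigr),$$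 where $$R_{1,k}(u)=\frac{(-12k^2+24k-2)+(-24k^2+24k+18)u+(-12k^2-12k+20)u^2+(-12k+3)u^3-2u^4}{24(u+1)^3}$$ and $R_{2,k}(u)=\dfrac{N_k(u)}{1152(u+1)^6}$ with $$\begin{aligned}N_k(u)={}&(144k^4-384k^3+624k^2-1152k+100)+(576k^4-576k^3+816k^2-3264k-648)u\\&+(864k^4+1056k^3+432k^2-6384k-1292)u^2+(576k^4+2784k^3+2280k^2-7440k-2604)u^3\\&+(144k^4+2016k^3+3888k^2-3552k-2988)u^4+(480k^3+2328k^2+72k-1800)u^5\\&+(480k^2+600k-551)u^6+(144k-60)u^7+4u^8.\end{aligned}$$ 3. Consequently $$\frac{B_{n+k}}{B_n}=\frac{(n+k)!}{n!}\,\alpha_n^{-k}\bigl(1+O(e^{-\alpha_n})\bigr),$$ and also $$\frac{B_{n+k}}{B_n}=\frac{(n+k)!}{n!}\,\alpha_n^{-k}\Bigl(1-\frac{k\alpha_n}{(n+1)(\alpha_n+1)}\Bigr)^{-1/2}\bigl(1+O(e^{-\alpha_n})\bigr).$$ -/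

import Mathlib

namespace BellAsymptotics

/-- The equation `u * exp u = n + 1` has exactly one positive real solution. -/
theorem existsUnique_alpha (n : ℕ) :
    ∃! u : ℝ, 0 < u ∧ u * Real.exp u = (n : ℝ) + 1 := by
  have hn : (0 : ℝ) ≤ n := Nat.cast_nonneg n
  have hmono : ∀ a b : ℝ, 0 < a → a < b → a * Real.exp a < b * Real.exp b := by
    intro a b ha hab
    exact mul_lt_mul hab (Real.exp_le_exp.2 hab.le) (Real.exp_pos a) (ha.trans hab).le
  have hcont : ContinuousOn (fun u : ℝ => u * Real.exp u) (Set.Icc 0 ((n : ℝ) + 1)) := by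
    fun_prop
  have hmem : (n : ℝ) + 1 ∈ Set.Icc ((0 : ℝ) * Real.exp 0)
      (((n : ℝ) + 1) * Real.exp ((n : ℝ) + 1)) := by
    constructor
    · simp only [zero_mul]
      linarith
    · have h1 : (1 : ℝ) ≤ Real.exp ((n : ℝ) + 1) := Real.one_le_exp (by linarith)
      nlinarith
  obtain ⟨u, hu, hfu⟩ := intermediate_value_Icc (by linarith : (0 : ℝ) ≤ (n : ℝ) + 1) hcont hmem
  simp only at hfu
  have hpos : 0 < u := by
    rcases hu.1.lt_or_eq with h | h
    · exact h
    · exfalso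
      rw [← h, zero_mul] at hfu
      linarith
  refine ⟨u, ⟨hpos, hfu⟩, ?_⟩
  rintro v ⟨hv, hfv⟩
  rcases lt_trichotomy v u with h | h | h
  · have := hmono v u hv h
    linarith
  · exact h
  · have := hmono u v hpos h
    linarith

/-- `α_n`, the positive real solution of `u * exp u = n + 1`. -/
noncomputable def alpha (n : ℕ) : ℝ := (existsUnique_alpha n).choose

theorem alpha_spec (n : ℕ) :
    0 < alpha n ∧ alpha n * Real.exp (alpha n) = (n : ℝ) + 1 :=
  (existsUnique_alpha n).choose_spec.1

/-- `ζ_{n,k} = e^{α_n} (1 + 1/α_n) + k/α_n²`. -/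
noncomputable def zeta (n : ℕ) (k : ℤ) : ℝ :=
  Real.exp (alpha n) * (1 + 1 / alpha n) + (k : ℝ) / alpha n ^ 2

/-- The Bell number `B_{n+k}`; the shift `k` may be negative, and only indices
with `n + k ≥ 0` are meant. -/
def shiftedBell (n : ℕ) (k : ℤ) : ℕ := Nat.bell ((n : ℤ) + k).toNat

/-- The factorial `(n+k)!`; only indices with `n + k ≥ 0` are meant. -/
def shiftedFactorial (n : ℕ) (k : ℤ) : ℕ := Nat.factorial ((n : ℤ) + k).toNat

/-- The main term
`(n+k)! / (√(2π) e) · ζ_{n,k}^{-1/2} · exp (e^{α_n} - (n+k+1) log α_n)`. -/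
noncomputable def bellMain (n : ℕ) (k : ℤ) : ℝ :=
  (shiftedFactorial n k : ℝ) / (Real.sqrt (2 * Real.pi) * Real.exp 1) *
    zeta n k ^ (-(1 / 2) : ℝ) *
    Real.exp (Real.exp (alpha n) - ((n : ℝ) + (k : ℝ) + 1) * Real.log (alpha n))

/-- The explicit first coefficient `R_{1,k}(u)`. -/
def R₁ {F : Type*} [Field F] (k u : F) : F :=
  ((-12 * k ^ 2 + 24 * k - 2) + (-24 * k ^ 2 + 24 * k + 18) * u
    + (-12 * k ^ 2 - 12 * k + 20) * u ^ 2 + (-12 * k + 3) * u ^ 3 - 2 * u ^ 4)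
    / (24 * (u + 1) ^ 3)

/-- The explicit second coefficient `R_{2,k}(u)`. -/
def R₂ {F : Type*} [Field F] (k u : F) : F :=
  ((144 * k ^ 4 - 384 * k ^ 3 + 624 * k ^ 2 - 1152 * k + 100)
    + (576 * k ^ 4 - 576 * k ^ 3 + 816 * k ^ 2 - 3264 * k - 648) * u
    + (864 * k ^ 4 + 1056 * k ^ 3 + 432 * k ^ 2 - 6384 * k - 1292) * u ^ 2
    + (576 * k ^ 4 + 2784 * k ^ 3 + 2280 * k ^ 2 - 7440 * k - 2604) * u ^ 3
    + (144 * k ^ 4 + 2016 * k ^ 3 + 3888 * k ^ 2 - 3552 * k - 2988) * u ^ 4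
    + (480 * k ^ 3 + 2328 * k ^ 2 + 72 * k - 1800) * u ^ 5
    + (480 * k ^ 2 + 600 * k - 551) * u ^ 6
    + (144 * k - 60) * u ^ 7 + 4 * u ^ 8)
    / (1152 * (u + 1) ^ 6)

end BellAsymptotics

/-! ### Dobinski's series and the Laplace kernel on a vertical line. -/

namespace BellAsymptotics
open MeasureTheory Filter Topology Set
open scoped FourierTransform

/-! The proof is a saddle-point analysis of an exact integral. Dobinski's series gives `e * B_N = ∑
m ^ N / m!`, and Fourier inversion writes `m ^ N * exp (-r m)` as an integral of `exp (i m t) * (1 +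
i t / r) ^ (-(N + 1))`. Summing over `m` yields `bell_eq_line_integral`: up to explicit factors,
`B_N` is the integral over real `t` of `exp (e ^ r * (e ^ (i t) - 1)) * (1 + i t / r) ^ (-(N + 1))`,
for any `r > 0`.

Take `r = α_n`, `v = 1 / r`, `N = n + k`, `y = i t`, so that `e ^ r = (n + 1) v`. The exponent is
`n` times `v (e ^ y - 1) - log (1 + v y)`, plus a part independent of `n`. The linear terms of the
first bracket cancel, and its quadratic term gives the Gaussian `exp (-(1 + v) Λ t² / 2)` with `Λ =
n v = n / α_n`. All later terms of the first part carry the factor `Λ t²`. With `w = Λ t²` held as a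
parameter, the non-Gaussian factor is the exponential of a power series in `y` whose coefficients
are bounded by `w + 2 + |k|`. Cauchy's estimate bounds its Taylor remainder with a loss of only `exp
(w / 8)`, which the Gaussian absorbs. Integrating term by term gives `exists_norm_integral_sub_le`,
an expansion in powers of `1 / Λ` with constants uniform in `0 < v ≤ 1`; uniformity is essential
because `v = 1 / α_n` tends to `0`.

Since `ζ_{n,k}` is the Gaussian width `(1 + v) Λ` times `1 + κ / n` with `κ` bounded, multiplying by
the binomial series of `(1 + κ / n) ^ (1 / 2)` gives the full expansion
(`exists_hasExpansion_shiftedBell`). The coefficients are rational in `α_n` because every step of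
their construction is, and the first two are computed explicitly. As `e ^ (-α_n) = α_n / (n + 1)`,
the expansion cut after its constant term is the `O(e ^ (-α_n))` statement. In the quotient by `B_n`
all factors of the main term independent of `k`, apart from the factorial, cancel. -/

/-- Dobinski's formula. -/
theorem hasSum_dobinski (N : ℕ) :
    HasSum (fun m : ℕ => (m : ℝ) ^ N / (m.factorial : ℝ)) (Real.exp 1 * Nat.bell N) := by
  induction N using Nat.strong_induction_on with
  | _ N ih =>
    rcases N with _ | N
    · simpa [Real.exp_eq_exp_ℝ] using NormedSpace.expSeries_div_hasSum_exp (1 : ℝ)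
    -- The term `m = 0` vanishes because the exponent is positive. After the shift, `(m + 1) ^ (N +
    -- 1) / (m + 1)! = (1 + m) ^ N / m!`, and the binomial theorem turns the series into the Bell
    -- recurrence.
    · rw [← hasSum_nat_add_iff' 1]
      have h : HasSum (fun m : ℕ => ∑ i ∈ Finset.range (N + 1),
          (N.choose i : ℝ) * ((m : ℝ) ^ (N - i) / (m.factorial : ℝ)))
          (∑ i ∈ Finset.range (N + 1), (N.choose i : ℝ) * (Real.exp 1 * Nat.bell (N - i))) :=
        hasSum_sum fun i _ => (ih (N - i) (by omega)).mul_left _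
      convert! h using 1
      · funext m
        have hm : (m.factorial : ℝ) ≠ 0 := by positivity
        have h1 : ((m : ℝ) + 1) ≠ 0 := by positivity
        have h2 := add_pow (1 : ℝ) (m : ℝ) N
        rw [Nat.factorial_succ]
        push_cast
        calc ((m : ℝ) + 1) ^ (N + 1) / (((m : ℝ) + 1) * m.factorial)
            = (1 + (m : ℝ)) ^ N / m.factorial := by field_simp; ring
          _ = _ := by
            rw [h2, Finset.sum_div]
            exact Finset.sum_congr rfl fun i _ => by rw [one_pow]; ring
      · rw [Nat.bell_succ, Finset.sum_range_one, ← Nat.range_succ_eq_Iic]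
        push_cast
        rw [Finset.mul_sum]
        simp only [Nat.factorial_zero, Nat.cast_one, div_one, ne_eq, Nat.add_eq_zero_iff,
          one_ne_zero, and_false, not_false_eq_true, zero_pow, sub_zero]
        exact Finset.sum_congr rfl fun i _ => by ring

theorem integrableOn_pow_mul_cexp (N : ℕ) {a : ℂ} (ha : 0 < a.re) :
    IntegrableOn (fun x : ℝ => (x : ℂ) ^ N * Complex.exp (-a * x)) (Ioi 0) := by
  have h := integrableOn_rpow_mul_exp_neg_mul_rpow (s := N) (p := 1) (b := a.re)
    (by have : (0 : ℝ) ≤ N := Nat.cast_nonneg N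
        linarith) one_pos ha
  refine h.mono' (by fun_prop) ?_
  filter_upwards [ae_restrict_mem measurableSet_Ioi] with x hx
  rw [norm_mul, norm_pow, Complex.norm_exp, Complex.norm_real, Real.norm_of_nonneg (le_of_lt hx)]
  simp

/-- Induction on `N`: the derivative of `x ^ (N + 1) * exp (-a x)` integrates to zero over the
half-line, which links consecutive exponents. -/
theorem integral_pow_mul_cexp (N : ℕ) {a : ℂ} (ha : 0 < a.re) :
    ∫ x : ℝ in Ioi 0, (x : ℂ) ^ N * Complex.exp (-a * x) = N.factorial / a ^ (N + 1) := by
  have ha0 : a ≠ 0 := by rintro rfl; simp at ha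
  induction N with
  | zero =>
    have := integral_exp_mul_complex_Ioi (a := -a) (by simpa using ha) 0
    simp only [pow_zero, one_mul, this]
    simp [neg_div_neg_eq]
  | succ N ih =>
    have hd : ∀ x ∈ Ioi (0 : ℝ), HasDerivAt
        (fun x : ℝ => (x : ℂ) ^ (N + 1) * Complex.exp (-a * x))
        ((N + 1) * ((x : ℂ) ^ N * Complex.exp (-a * x))
          - a * ((x : ℂ) ^ (N + 1) * Complex.exp (-a * x))) x := by
      intro x _
      have h1 : HasDerivAt (fun x : ℝ => (x : ℂ)) 1 x := Complex.ofRealCLM.hasDerivAt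
      have h2 := (h1.pow (N + 1)).mul ((h1.const_mul (-a)).cexp)
      convert! h2 using 1
      push_cast
      simp
      ring
    have hi0 := (integrableOn_pow_mul_cexp N ha).const_mul ((N : ℂ) + 1)
    have hi1 := (integrableOn_pow_mul_cexp (N + 1) ha).const_mul a
    have hlim : Tendsto (fun x : ℝ => (x : ℂ) ^ (N + 1) * Complex.exp (-a * x)) atTop (𝓝 0) := by
      rw [tendsto_zero_iff_norm_tendsto_zero]
      have h3 := (tendsto_rpow_mul_exp_neg_mul_atTop_nhds_zero (N + 1 : ℕ) a.re ha)
      refine h3.congr' ?_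
      filter_upwards [eventually_ge_atTop 0] with x hx
      rw [norm_mul, norm_pow, Complex.norm_exp, Complex.norm_real, Real.norm_of_nonneg hx]
      simp [← Real.rpow_natCast]
    have hc : ContinuousWithinAt (fun x : ℝ => (x : ℂ) ^ (N + 1) * Complex.exp (-a * x))
        (Ici 0) 0 := by fun_prop
    have hI := integral_Ioi_of_hasDerivAt_of_tendsto hc hd (hi0.sub hi1) hlim
    rw [integral_sub hi0 hi1, integral_const_mul, integral_const_mul, ih] at hI
    simp only [Complex.ofReal_zero, ne_eq, Nat.add_eq_zero_iff, one_ne_zero, and_false,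
      not_false_eq_true, zero_pow, zero_mul, sub_zero, sub_eq_zero] at hI
    rw [eq_div_iff (pow_ne_zero _ ha0), Nat.factorial_succ, pow_succ, mul_comm _ a, ← mul_assoc,
      mul_comm _ a, ← hI]
    push_cast
    field_simp

theorem integrable_inv_one_add_mul_sq {v : ℝ} (hv : v ≠ 0) :
    Integrable fun t : ℝ => (1 + (v * t) ^ 2)⁻¹ :=
  integrable_inv_one_add_sq.comp_mul_left' hv

theorem norm_one_add_mul_I_sq (x : ℝ) : ‖1 + (x : ℂ) * Complex.I‖ ^ 2 = 1 + x ^ 2 := by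
  rw [Complex.sq_norm, Complex.normSq_apply]
  simp
  ring

theorem norm_one_add_mul_I_ge (x : ℝ) : 1 ≤ ‖1 + (x : ℂ) * Complex.I‖ := by
  have := norm_one_add_mul_I_sq x
  nlinarith [norm_nonneg (1 + (x : ℂ) * Complex.I), sq_nonneg x]

theorem norm_inv_one_add_mul_I_pow_le (x : ℝ) {N : ℕ} (hN : 1 ≤ N) :
    ‖((1 + (x : ℂ) * Complex.I) ^ (N + 1))⁻¹‖ ≤ (1 + x ^ 2)⁻¹ := by
  rw [norm_inv, norm_pow]
  refine inv_anti₀ (by positivity) ?_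
  rw [← norm_one_add_mul_I_sq]
  exact pow_le_pow_right₀ (norm_one_add_mul_I_ge x) (by omega)

theorem one_add_mul_I_ne_zero (x : ℝ) : 1 + (x : ℂ) * Complex.I ≠ 0 := by
  intro h
  have := norm_one_add_mul_I_ge x
  rw [h, norm_zero] at this
  linarith

theorem integrable_inv_line_pow {v : ℝ} (hv : v ≠ 0) {N : ℕ} (hN : 1 ≤ N) :
    Integrable fun t : ℝ => ((1 + ((v * t : ℝ) : ℂ) * Complex.I) ^ (N + 1))⁻¹ := by
  refine (integrable_inv_one_add_mul_sq hv).mono' ?_ ?_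
  · refine Continuous.aestronglyMeasurable ?_
    refine Continuous.inv₀ (by fun_prop) fun t => pow_ne_zero _ (one_add_mul_I_ne_zero _)
  · exact Eventually.of_forall fun t => norm_inv_one_add_mul_I_pow_le _ hN

end BellAsymptotics

/-! ### The Bell number as an integral over a vertical line. -/

namespace BellAsymptotics
open MeasureTheory Filter Topology Set
open scoped FourierTransform

/-- The positive part makes the function visibly continuous when `N ≥ 1`; the indicator is what
keeps the formula valid for `N = 0`, where the power is identically `1`. -/
theorem fourier_posPart_pow_mul_exp (N : ℕ) {r : ℝ} (hr : 0 < r) (ξ : ℝ) :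
    𝓕 (fun x : ℝ => (((max x 0) ^ N * Real.exp (-r * x) : ℝ) : ℂ) *
        (if 0 < x then 1 else 0)) ξ =
      N.factorial / (r : ℂ) ^ (N + 1) *
        ((1 + ((r⁻¹ * (2 * Real.pi * ξ) : ℝ) : ℂ) * Complex.I) ^ (N + 1))⁻¹ := by
  have hre : 0 < ((r : ℂ) + (2 * Real.pi * ξ : ℝ) * Complex.I).re := by simpa using hr
  have hr0 : (r : ℂ) ≠ 0 := by exact_mod_cast hr.ne'
  rw [Real.fourier_real_eq_integral_exp_smul]
  have h := integral_pow_mul_cexp N hre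
  have h2 : (∫ v : ℝ, Complex.exp (↑(-2 * Real.pi * v * ξ) * Complex.I) •
      ((((max v 0) ^ N * Real.exp (-r * v) : ℝ) : ℂ) * (if 0 < v then 1 else 0))) =
      ∫ x : ℝ in Ioi 0, (x : ℂ) ^ N *
        Complex.exp (-((r : ℂ) + (2 * Real.pi * ξ : ℝ) * Complex.I) * x) := by
    rw [← integral_indicator measurableSet_Ioi]
    refine integral_congr_ae (Eventually.of_forall fun x => ?_)
    by_cases hx : 0 < x
    · simp only [hx, indicator_of_mem, mem_Ioi, if_true, mul_one, max_eq_left hx.le, smul_eq_mul]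
      push_cast
      rw [mul_left_comm, ← Complex.exp_add]
      congr 2
      ring
    · simp [hx]
  rw [h2, h, div_mul_eq_mul_div, ← div_eq_mul_inv, div_div, ← mul_pow]
  congr 2
  push_cast
  field_simp

/-- Fourier inversion of the preceding transform, evaluated at the point `m`. The condition `1 ≤ N`
makes the function continuous at `0` and its transform integrable. -/
theorem integral_cexp_mul_line {N : ℕ} (hN : 1 ≤ N) {r : ℝ} (hr : 0 < r) (m : ℕ) :
    ∫ t : ℝ, Complex.exp (m * (t * Complex.I)) *
        ((1 + ((r⁻¹ * t : ℝ) : ℂ) * Complex.I) ^ (N + 1))⁻¹ =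
      2 * Real.pi * r ^ (N + 1) / N.factorial * (m ^ N * Real.exp (-(r * m))) := by
  set f : ℝ → ℂ := fun x : ℝ => (((max x 0) ^ N * Real.exp (-r * x) : ℝ) : ℂ) *
        (if 0 < x then 1 else 0) with hf
  have hfeq : f = fun x : ℝ => (((max x 0) ^ N * Real.exp (-r * x) : ℝ) : ℂ) := by
    funext x
    by_cases hx : 0 < x
    · simp [hf, hx]
    · have : max x 0 = 0 := max_eq_right (not_lt.1 hx)
      simp [hf, hx, this, Nat.pos_iff_ne_zero.1 hN]
  have hcont : Continuous f := by rw [hfeq]; fun_prop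
  have hint : Integrable f := by
    rw [← integrableOn_univ, ← Iic_union_Ioi (a := (0 : ℝ))]
    refine IntegrableOn.union ?_ ?_
    · refine integrableOn_zero.congr_fun (fun x hx => ?_) measurableSet_Iic
      simp [hf, not_lt.2 (mem_Iic.1 hx)]
    · refine (integrableOn_pow_mul_cexp N (a := r) (by simpa using hr)).congr_fun
        (fun x hx => ?_) measurableSet_Ioi
      have hx' : 0 < x := hx
      simp [hf, hx', max_eq_left hx'.le]
  have hF : 𝓕 f = fun ξ : ℝ => N.factorial / (r : ℂ) ^ (N + 1) *
        ((1 + ((r⁻¹ * (2 * Real.pi * ξ) : ℝ) : ℂ) * Complex.I) ^ (N + 1))⁻¹ := by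
    funext ξ
    exact fourier_posPart_pow_mul_exp N hr ξ
  have hFint : Integrable (𝓕 f) := by
    rw [hF]
    refine Integrable.const_mul ?_ _
    exact (integrable_inv_line_pow (inv_ne_zero hr.ne') hN).comp_mul_left'
      (mul_ne_zero two_ne_zero Real.pi_ne_zero)
  have hinv := congrFun (hcont.fourierInv_fourier_eq hint hFint) (m : ℝ)
  rw [hF, Real.fourierInv_eq'] at hinv
  have hscale := Measure.integral_comp_mul_left (fun t : ℝ => Complex.exp (m * (t * Complex.I)) *
        ((1 + ((r⁻¹ * t : ℝ) : ℂ) * Complex.I) ^ (N + 1))⁻¹) (2 * Real.pi)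
  have hr0 : (r : ℂ) ≠ 0 := by exact_mod_cast hr.ne'
  have hNf : (N.factorial : ℂ) ≠ 0 := by exact_mod_cast N.factorial_ne_zero
  have hpi : (Real.pi : ℂ) ≠ 0 := by exact_mod_cast Real.pi_ne_zero
  have h3 : (∫ v : ℝ, Complex.exp (↑(2 * Real.pi * inner ℝ v (m : ℝ)) * Complex.I) •
      (N.factorial / (r : ℂ) ^ (N + 1) *
        ((1 + ((r⁻¹ * (2 * Real.pi * v) : ℝ) : ℂ) * Complex.I) ^ (N + 1))⁻¹)) =
      N.factorial / (r : ℂ) ^ (N + 1) * ∫ v : ℝ,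
        Complex.exp (m * (((2 * Real.pi * v : ℝ) : ℂ) * Complex.I)) *
        ((1 + ((r⁻¹ * (2 * Real.pi * v) : ℝ) : ℂ) * Complex.I) ^ (N + 1))⁻¹ := by
    rw [← integral_const_mul]
    refine integral_congr_ae (Eventually.of_forall fun x => ?_)
    simp only [smul_eq_mul]
    rw [mul_left_comm]
    congr 3
    simp
    ring
  rw [h3, hscale] at hinv
  have hfm : f m = m ^ N * Real.exp (-(r * m)) := by
    rw [hfeq]
    simp
  rw [hfm, abs_of_pos (by positivity), Complex.real_smul] at hinv
  rw [← hinv]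
  generalize (∫ y : ℝ, Complex.exp (m * (y * Complex.I)) *
        ((1 + ((r⁻¹ * y : ℝ) : ℂ) * Complex.I) ^ (N + 1))⁻¹) = J
  push_cast
  field_simp

/-- The Bell numbers as an integral over the vertical line with real part `r`. -/
theorem bell_eq_line_integral {N : ℕ} (hN : 1 ≤ N) {r : ℝ} (hr : 0 < r) :
    ∫ t : ℝ, Complex.exp (Real.exp r * (Complex.exp (t * Complex.I) - 1)) *
        ((1 + ((r⁻¹ * t : ℝ) : ℂ) * Complex.I) ^ (N + 1))⁻¹ =
      ((2 * Real.pi * Real.exp 1 * r ^ (N + 1) * Real.exp (-Real.exp r) / N.factorial *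
        Nat.bell N : ℝ) : ℂ) := by
  set K : ℝ → ℂ := fun t => ((1 + ((r⁻¹ * t : ℝ) : ℂ) * Complex.I) ^ (N + 1))⁻¹ with hK
  have hKint : Integrable K := integrable_inv_line_pow (inv_ne_zero hr.ne') hN
  set c : ℂ := ((Real.exp (-Real.exp r) : ℝ) : ℂ) with hc
  set F : ℕ → ℝ → ℂ := fun m t => ((Real.exp (r * m) / m.factorial : ℝ) : ℂ) *
      (Complex.exp (m * (t * Complex.I)) * K t) with hF
  have hnorm : ∀ (m : ℕ) (t : ℝ), ‖Complex.exp (m * (t * Complex.I))‖ = 1 := by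
    intro m t
    rw [Complex.norm_exp]
    simp
  have hFint : ∀ m, Integrable (F m) := by
    intro m
    refine Integrable.const_mul ?_ _
    refine hKint.bdd_mul (c := 1) ?_ (Eventually.of_forall fun t => (hnorm m t).le)
    exact Continuous.aestronglyMeasurable (by fun_prop)
  have hexp : ∀ m : ℕ, Real.exp (r * m) / m.factorial = (Real.exp r) ^ m / m.factorial := by
    intro m
    rw [mul_comm, Real.exp_nat_mul]
  -- The exponentials have modulus one on the line, so the norms sum to an exponential series times
  -- the `L¹` norm of `K`; this permits exchanging sum and integral.
  have hsum : Summable fun m => ∫ t, ‖F m t‖ := by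
    have : ∀ m, ∫ t, ‖F m t‖ = (Real.exp r) ^ m / m.factorial * ∫ t, ‖K t‖ := by
      intro m
      rw [← integral_const_mul]
      refine integral_congr_ae (Eventually.of_forall fun t => ?_)
      simp only [hF, norm_mul, hnorm, one_mul]
      rw [Complex.norm_real, hexp, Real.norm_of_nonneg (by positivity)]
    simp_rw [this]
    exact (Real.summable_pow_div_factorial _).mul_right _
  have hmain := hasSum_integral_of_summable_integral_norm hFint hsum
  -- The weight `exp (r m)` cancels the damping `exp (-r m)`, leaving a term of Dobinski's series.
  have hterm : ∀ m, ∫ t, F m t = ((2 * Real.pi * r ^ (N + 1) / N.factorial *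
      ((m : ℝ) ^ N / m.factorial) : ℝ) : ℂ) := by
    intro m
    simp only [hF]
    rw [integral_const_mul, integral_cexp_mul_line hN hr m, Real.exp_neg]
    have h1 : (Real.exp (r * m) : ℂ) ≠ 0 := by exact_mod_cast (Real.exp_pos _).ne'
    push_cast at h1 ⊢
    field_simp
  have hpt : ∀ t : ℝ, ∑' m, F m t = Complex.exp (Real.exp r * Complex.exp (t * Complex.I)) * K t := by
    intro t
    have h1 := NormedSpace.expSeries_div_hasSum_exp (𝔸 := ℂ)
      ((Real.exp r : ℂ) * Complex.exp (t * Complex.I))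
    rw [← Complex.exp_eq_exp_ℂ] at h1
    rw [← (h1.mul_right (K t)).tsum_eq]
    refine tsum_congr fun m => ?_
    simp only [hF]
    rw [hexp, mul_pow, ← Complex.exp_nat_mul]
    push_cast
    ring
  simp_rw [hterm, hpt] at hmain
  have hD := ((hasSum_dobinski N).mul_left (2 * Real.pi * r ^ (N + 1) / N.factorial))
  have huniq := hmain.unique (Complex.hasSum_ofReal.2 hD)
  calc _ = ∫ t : ℝ, c * (Complex.exp (Real.exp r * Complex.exp (t * Complex.I)) * K t) := by
        refine integral_congr_ae (Eventually.of_forall fun t => ?_)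
        simp only [hc]
        rw [← mul_assoc, Complex.ofReal_exp (-Real.exp r), ← Complex.exp_add]
        congr 2
        rw [Complex.ofReal_neg]
        ring
    _ = _ := by
        rw [integral_const_mul, huniq, hc]
        push_cast
        ring

end BellAsymptotics

/-! ### Exponentials of power series with bounded coefficients. -/

namespace BellAsymptotics
open Filter Topology Set Metric

/-- Coefficients of the exponential of the power series with coefficients `e` and zero
constant term. -/
noncomputable def expCoeff {A : Type*} [CommRing A] [Algebra ℚ A] (e : ℕ → A) : ℕ → A
  | 0 => 1
  | j + 1 => algebraMap ℚ A (1 / ((j : ℚ) + 1)) *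
      ∑ i : Fin (j + 1), ((i : ℕ) + 1 : A) * e (i + 1) * expCoeff e (j - i)

theorem expCoeff_zero {A : Type*} [CommRing A] [Algebra ℚ A] (e : ℕ → A) : expCoeff e 0 = 1 := by
  rw [expCoeff]

theorem expCoeff_succ {A : Type*} [CommRing A] [Algebra ℚ A] (e : ℕ → A) (j : ℕ) :
    expCoeff e (j + 1) = algebraMap ℚ A (1 / ((j : ℚ) + 1)) *
      ∑ i ∈ Finset.range (j + 1), ((i : A) + 1) * e (i + 1) * expCoeff e (j - i) := by
  rw [expCoeff, Finset.sum_range]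

theorem map_expCoeff {A B : Type*} [CommRing A] [Algebra ℚ A] [CommRing B] [Algebra ℚ B]
    (φ : A →+* B) (e : ℕ → A) (j : ℕ) : φ (expCoeff e j) = expCoeff (fun i => φ (e i)) j := by
  induction j using Nat.strong_induction_on with
  | _ j ih =>
    rcases j with _ | j
    · simp [expCoeff_zero]
    · rw [expCoeff_succ, expCoeff_succ, map_mul, map_sum]
      congr 1
      · exact RingHom.congr_fun (Subsingleton.elim (φ.comp (algebraMap ℚ A)) (algebraMap ℚ B)) _
      · refine Finset.sum_congr rfl fun i hi => ?_
        rw [map_mul, map_mul, ih (j - i) (by omega)]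
        simp

section PowerSeriesExp

variable {e : ℕ → ℂ} {M : ℝ}

theorem hasFPowerSeriesOnBall_of_bounded (he : ∀ j, ‖e j‖ ≤ M) :
    HasFPowerSeriesOnBall (fun y => ∑' j, e j * y ^ j)
      (FormalMultilinearSeries.ofScalars ℂ e) 0 1 := by
  have hr : 1 ≤ (FormalMultilinearSeries.ofScalars ℂ e).radius := by
    have := (FormalMultilinearSeries.ofScalars ℂ e).le_radius_of_bound M (r := 1)
      (fun n => by simpa [FormalMultilinearSeries.ofScalars_norm] using he n)
    simpa using this
  have h := ((FormalMultilinearSeries.ofScalars ℂ e).hasFPowerSeriesOnBall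
    (lt_of_lt_of_le one_pos hr)).mono one_pos hr
  convert! h using 1
  funext y
  have := FormalMultilinearSeries.ofScalars_sum_eq (𝕜 := ℂ) e y
  rw [FormalMultilinearSeries.ofScalarsSum] at this
  rw [this]
  simp [smul_eq_mul]

theorem differentiableOn_tsum_of_bounded (he : ∀ j, ‖e j‖ ≤ M) :
    DifferentiableOn ℂ (fun y => ∑' j, e j * y ^ j) (ball 0 1) := by
  have := (hasFPowerSeriesOnBall_of_bounded he).differentiableOn
  rwa [← ENNReal.ofReal_one, Metric.eball_ofReal] at this

theorem iteratedDeriv_tsum_of_bounded (he : ∀ j, ‖e j‖ ≤ M) (j : ℕ) :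
    iteratedDeriv j (fun y => ∑' j, e j * y ^ j) 0 = j.factorial * e j := by
  have h1 := (hasFPowerSeriesOnBall_of_bounded he).hasFPowerSeriesAt
  have h2 := h1.analyticAt.hasFPowerSeriesAt
  have h3 := FormalMultilinearSeries.ofScalars_series_injective ℂ ℂ
    (h1.eq_formalMultilinearSeries h2)
  have h4 := congrFun h3 j
  have : (j.factorial : ℂ) ≠ 0 := by exact_mod_cast j.factorial_ne_zero
  rw [h4]
  field_simp

theorem norm_tsum_le_of_bounded (he0 : e 0 = 0) (he : ∀ j, ‖e j‖ ≤ M) {y : ℂ} (hy : ‖y‖ < 1) :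
    ‖∑' j, e j * y ^ j‖ ≤ M * (‖y‖ / (1 - ‖y‖)) := by
  have hg := (hasSum_geometric_of_lt_one (norm_nonneg y) hy).mul_left (M * ‖y‖)
  have hs : HasSum (fun j : ℕ => if j = 0 then (0 : ℝ) else M * ‖y‖ ^ j)
      (M * (‖y‖ / (1 - ‖y‖))) := by
    rw [← hasSum_nat_add_iff' 1]
    convert! hg using 1
    · funext j
      simp [pow_succ]
      ring
    · simp
      ring
  refine tsum_of_norm_bounded hs fun j => ?_
  rcases j with _ | j
  · simp [he0]
  · simp only [Nat.add_eq_zero_iff, one_ne_zero, and_false, if_false, norm_mul, norm_pow]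
    exact mul_le_mul_of_nonneg_right (he _) (by positivity)

/-- Leibniz's rule applied to `G' = S' * G` at `0` is exactly the recursion defining `expCoeff`. -/
theorem iteratedDeriv_exp_tsum (he0 : e 0 = 0) (he : ∀ j, ‖e j‖ ≤ M) (j : ℕ) :
    iteratedDeriv j (fun y => Complex.exp (∑' j, e j * y ^ j)) 0 =
      j.factorial * expCoeff e j := by
  set S : ℂ → ℂ := fun y => ∑' j, e j * y ^ j with hS
  have hSan : AnalyticAt ℂ S 0 :=
    (hasFPowerSeriesOnBall_of_bounded he).hasFPowerSeriesAt.analyticAt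
  have hGan : AnalyticAt ℂ (fun y => Complex.exp (S y)) 0 := hSan.cexp
  induction j using Nat.strong_induction_on with
  | _ j ih =>
    rcases j with _ | j
    · have : S 0 = 0 := by
        simp only [hS]
        rw [tsum_eq_single 0 (fun n hn => by simp [hn])]
        simp [he0]
      simp only [hS] at this
      simp [expCoeff_zero, this]
    · have hd : deriv (fun y => Complex.exp (S y)) =ᶠ[𝓝 0]
          (deriv S * fun y => Complex.exp (S y)) := by
        filter_upwards [hSan.eventually_analyticAt] with y hy
        rw [Pi.mul_apply, mul_comm]
        exact (hy.differentiableAt.hasDerivAt.cexp).deriv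
      rw [iteratedDeriv_succ', hd.iteratedDeriv_eq, iteratedDeriv_mul
        hSan.deriv.contDiffAt hGan.contDiffAt, expCoeff_succ, Finset.mul_sum, Finset.mul_sum]
      refine Finset.sum_congr rfl fun i hi => ?_
      rw [ih (j - i) (by omega), ← iteratedDeriv_succ', iteratedDeriv_tsum_of_bounded he,
        Nat.factorial_succ, Nat.factorial_succ]
      have hi' : i ≤ j := by simpa [Nat.lt_succ_iff] using hi
      have hc := Nat.choose_mul_factorial_mul_factorial hi'
      have hc' : (j.choose i : ℂ) * i.factorial * (j - i).factorial = j.factorial := by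
        exact_mod_cast hc
      have hj : (j : ℂ) + 1 ≠ 0 := by exact_mod_cast j.succ_ne_zero
      push_cast
      rw [← hc']
      simp
      field_simp

theorem differentiableOn_exp_tsum (he : ∀ j, ‖e j‖ ≤ M) :
    DifferentiableOn ℂ (fun y => Complex.exp (∑' j, e j * y ^ j)) (ball 0 1) :=
  (differentiableOn_tsum_of_bounded he).cexp

/-- Cauchy's estimate on the circle of radius `1 / 9`, where the series is at most `M * (1 / 9) / (8
/ 9) = M / 8`. The small radius keeps the growth in `M` slow enough for the Gaussian to absorb when
`M` contains `Λ t²`. -/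
theorem norm_expCoeff_le (he0 : e 0 = 0) (he : ∀ j, ‖e j‖ ≤ M) (j : ℕ) :
    ‖expCoeff e j‖ ≤ Real.exp (M / 8) * 9 ^ j := by
  have h := Complex.norm_iteratedDeriv_le_of_forall_mem_sphere_norm_le (c := 0) (R := 1 / 9)
    (C := Real.exp (M / 8)) (f := fun y => Complex.exp (∑' j, e j * y ^ j)) j (by norm_num)
    ((differentiableOn_exp_tsum he).diffContOnCl_ball (U := ball 0 1)
      (closedBall_subset_ball (by norm_num))) (fun z hz => by
        have hz' : ‖z‖ = 1 / 9 := by simpa using hz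
        refine (Complex.norm_exp_le_exp_norm _).trans (Real.exp_le_exp.2 ?_)
        refine (norm_tsum_le_of_bounded he0 he (by rw [hz']; norm_num)).trans (le_of_eq ?_)
        rw [hz']
        norm_num
        ring)
  rw [iteratedDeriv_exp_tsum he0 he, norm_mul, Complex.norm_natCast, mul_div_assoc] at h
  have h2 := le_of_mul_le_mul_left h (by positivity)
  refine h2.trans (le_of_eq ?_)
  rw [one_div, inv_pow, div_inv_eq_mul]

theorem hasSum_expCoeff (he0 : e 0 = 0) (he : ∀ j, ‖e j‖ ≤ M) {y : ℂ} (hy : ‖y‖ < 1) :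
    HasSum (fun j => expCoeff e j * y ^ j) (Complex.exp (∑' j, e j * y ^ j)) := by
  have h := Complex.hasSum_taylorSeries_on_ball (differentiableOn_exp_tsum he)
    (z := y) (by simpa using hy)
  convert! h using 1
  funext j
  rw [iteratedDeriv_exp_tsum he0 he]
  have : (j.factorial : ℂ) ≠ 0 := by exact_mod_cast j.factorial_ne_zero
  simp only [sub_zero, smul_eq_mul]
  field_simp

/-- The bound `1 / 18` is half the Cauchy radius, so the tail is dominated by a geometric series of
ratio `1 / 2`. -/
theorem norm_exp_tsum_sub_le (he0 : e 0 = 0) (he : ∀ j, ‖e j‖ ≤ M) {y : ℂ} (hy : ‖y‖ ≤ 1 / 18)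
    (J : ℕ) :
    ‖Complex.exp (∑' j, e j * y ^ j) - ∑ j ∈ Finset.range J, expCoeff e j * y ^ j‖ ≤
      Real.exp (M / 8) * (2 * 9 ^ J) * ‖y‖ ^ J := by
  have h1 := (hasSum_nat_add_iff' J).2 (hasSum_expCoeff he0 he (hy.trans_lt (by norm_num)))
  have h9 : 9 * ‖y‖ ≤ 1 / 2 := by linarith
  have hg := (hasSum_geometric_of_lt_one (r := 1 / 2) (by norm_num) (by norm_num)).mul_left
    (Real.exp (M / 8) * 9 ^ J * ‖y‖ ^ J)
  rw [← h1.tsum_eq]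
  refine (tsum_of_norm_bounded hg fun j => ?_).trans (le_of_eq ?_)
  · rw [norm_mul, norm_pow]
    calc ‖expCoeff e (j + J)‖ * ‖y‖ ^ (j + J)
        ≤ Real.exp (M / 8) * 9 ^ (j + J) * ‖y‖ ^ (j + J) :=
          mul_le_mul_of_nonneg_right (norm_expCoeff_le he0 he _) (by positivity)
      _ = Real.exp (M / 8) * 9 ^ J * ‖y‖ ^ J * (9 * ‖y‖) ^ j := by
          rw [mul_pow]
          ring
      _ ≤ _ := by gcongr
  · norm_num
    ring

end PowerSeriesExp

end BellAsymptotics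

/-! ### Taylor expansion of the phase at the saddle point. -/

namespace BellAsymptotics
open Filter Topology Set Polynomial

/-- Taylor coefficients of `(v (exp y - 1) - log (1 + v y) - v (1 + v) y² / 2) / (v y²)`. -/
noncomputable def cubicCoeff (v : ℝ) (j : ℕ) : ℝ :=
  if j = 0 then 0 else 1 / ((j + 2).factorial : ℝ) + (-1) ^ j * v ^ (j + 1) / ((j : ℝ) + 2)

/-- Taylor coefficients of `v (exp y - 1) - (1 + κ) log (1 + v y)`. -/
noncomputable def shiftCoeff (v κ : ℝ) (j : ℕ) : ℝ :=
  if j = 0 then 0 else v / (j.factorial : ℝ) + (-1) ^ j * v ^ j * (1 + κ) / (j : ℝ)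

/-- Taylor coefficients of the non-Gaussian part of the phase, as polynomials in `Λ t²`. -/
noncomputable def phaseCoeff (v κ : ℝ) (j : ℕ) : ℝ[X] :=
  C (shiftCoeff v κ j) - C (cubicCoeff v j) * X

/-- Taylor coefficients of the exponential of the non-Gaussian part of the phase. -/
noncomputable def amplitudeCoeff (v κ : ℝ) (j : ℕ) : ℝ[X] := expCoeff (phaseCoeff v κ) j

theorem natDegree_amplitudeCoeff_le (v κ : ℝ) (j : ℕ) : (amplitudeCoeff v κ j).natDegree ≤ j := by
  induction j using Nat.strong_induction_on with
  | _ j ih =>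
    rcases j with _ | j
    · simp [amplitudeCoeff, expCoeff_zero]
    · rw [amplitudeCoeff, expCoeff_succ]
      rw [IsScalarTower.algebraMap_apply ℚ ℝ ℝ[X], algebraMap_eq]
      refine (natDegree_C_mul_le _ _).trans (natDegree_sum_le_of_forall_le _ _ fun i hi => ?_)
      have h1 : (phaseCoeff v κ (i + 1)).natDegree ≤ 1 := by
        unfold phaseCoeff
        refine (natDegree_sub_le _ _).trans (max_le ?_ ?_)
        · simp
        · exact (natDegree_C_mul_le _ _).trans natDegree_X_le
      have h2 : ((i : ℝ[X]) + 1).natDegree ≤ 0 := by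
        have : ((i : ℝ[X]) + 1) = ((i + 1 : ℕ) : ℝ[X]) := by push_cast; rfl
        rw [this, natDegree_natCast]
      have h3 := ih (j - i) (by omega)
      have h4 := natDegree_mul_le (p := ((i : ℝ[X]) + 1)) (q := phaseCoeff v κ (i + 1))
      have h5 := natDegree_mul_le (p := ((i : ℝ[X]) + 1) * phaseCoeff v κ (i + 1))
        (q := amplitudeCoeff v κ (j - i))
      have hi' : i ≤ j := by simpa [Nat.lt_succ_iff] using hi
      unfold amplitudeCoeff at h3 h5
      omega

/-- Exponentiating coefficients commutes with specialising `X` to `w`. Analytic bounds are proved at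
each fixed `w`, while the polynomial form is used for integration. -/
theorem eval_amplitudeCoeff (v κ w : ℝ) (j : ℕ) :
    (((amplitudeCoeff v κ j).eval w : ℝ) : ℂ) =
      expCoeff (fun i => ((shiftCoeff v κ i - w * cubicCoeff v i : ℝ) : ℂ)) j := by
  have h := map_expCoeff (Complex.ofRealHom.comp (evalRingHom w)) (phaseCoeff v κ) j
  simp only [RingHom.comp_apply, coe_evalRingHom, Complex.ofRealHom_eq_coe] at h
  rw [amplitudeCoeff, h]
  congr 1
  funext i
  simp [phaseCoeff]
  ring

theorem abs_cubicCoeff_le {v : ℝ} (hv0 : 0 ≤ v) (hv1 : v ≤ 1) (j : ℕ) : |cubicCoeff v j| ≤ 1 := by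
  unfold cubicCoeff
  split_ifs with hj
  · simp
  · have h1 : |1 / ((j + 2).factorial : ℝ)| ≤ 1 / 2 := by
      rw [abs_of_nonneg (by positivity)]
      apply one_div_le_one_div_of_le two_pos
      have : 2 ≤ (j + 2).factorial := (Nat.le_add_left 2 j).trans (Nat.self_le_factorial _)
      exact_mod_cast this
    have h2 : |(-1) ^ j * v ^ (j + 1) / ((j : ℝ) + 2)| ≤ 1 / 2 := by
      rw [abs_div, abs_mul, abs_pow, abs_neg, abs_one, one_pow, one_mul,
        abs_of_nonneg (by positivity), abs_of_nonneg (by positivity : (0 : ℝ) ≤ (j : ℝ) + 2)]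
      exact div_le_div₀ one_pos.le (pow_le_one₀ hv0 hv1) two_pos
        (by linarith [Nat.cast_nonneg (α := ℝ) j])
    linarith [abs_add_le (1 / ((j + 2).factorial : ℝ)) ((-1) ^ j * v ^ (j + 1) / ((j : ℝ) + 2))]

theorem abs_shiftCoeff_le {v : ℝ} (hv0 : 0 ≤ v) (hv1 : v ≤ 1) (κ : ℝ) (j : ℕ) :
    |shiftCoeff v κ j| ≤ 2 + |κ| := by
  unfold shiftCoeff
  split_ifs with hj
  · simp
    positivity
  · have hj1 : (1 : ℝ) ≤ j := by exact_mod_cast Nat.one_le_iff_ne_zero.2 hj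
    have h1 : |v / (j.factorial : ℝ)| ≤ 1 := by
      rw [abs_of_nonneg (by positivity)]
      apply div_le_one_of_le₀ _ (by positivity)
      exact hv1.trans (by exact_mod_cast Nat.factorial_pos j)
    have h2 : |(-1) ^ j * v ^ j * (1 + κ) / (j : ℝ)| ≤ 1 + |κ| := by
      rw [abs_div, abs_mul, abs_mul, abs_pow, abs_neg, abs_one, one_pow, one_mul,
        abs_of_nonneg (by positivity : (0 : ℝ) ≤ v ^ j), abs_of_nonneg (by positivity : (0 : ℝ) ≤ j)]
      refine (div_le_self (by positivity) hj1).trans ?_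
      refine (mul_le_of_le_one_left (abs_nonneg _) (pow_le_one₀ hv0 hv1)).trans ?_
      simpa using abs_add_le 1 κ
    linarith [abs_add_le (v / (j.factorial : ℝ)) ((-1) ^ j * v ^ j * (1 + κ) / (j : ℝ))]

theorem norm_phase_le {v w : ℝ} (hv0 : 0 ≤ v) (hv1 : v ≤ 1) (hw : 0 ≤ w) (κ : ℝ) (j : ℕ) :
    ‖((shiftCoeff v κ j - w * cubicCoeff v j : ℝ) : ℂ)‖ ≤ w + (2 + |κ|) := by
  rw [Complex.norm_real, Real.norm_eq_abs]
  have h1 := abs_sub (shiftCoeff v κ j) (w * cubicCoeff v j)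
  have h2 : |w * cubicCoeff v j| ≤ w := by
    rw [abs_mul, abs_of_nonneg hw]
    exact mul_le_of_le_one_right hw (abs_cubicCoeff_le hv0 hv1 j)
  linarith [abs_shiftCoeff_le hv0 hv1 κ j]

theorem hasSum_shiftCoeff {v : ℝ} (hv0 : 0 ≤ v) (hv1 : v ≤ 1) (κ : ℝ) {y : ℂ} (hy : ‖y‖ < 1) :
    HasSum (fun j => (shiftCoeff v κ j : ℂ) * y ^ j)
      (v * (Complex.exp y - 1) - (1 + κ) * Complex.log (1 + v * y)) := by
  have hvy : ‖(v : ℂ) * y‖ < 1 := by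
    rw [norm_mul, Complex.norm_real, Real.norm_of_nonneg hv0]
    exact (mul_le_of_le_one_left (norm_nonneg _) hv1).trans_lt hy
  have h1 := (NormedSpace.expSeries_div_hasSum_exp (𝔸 := ℂ) y).mul_left (v : ℂ)
  rw [← Complex.exp_eq_exp_ℂ] at h1
  have h2 := (Complex.hasSum_taylorSeries_log hvy).mul_left (1 + κ : ℂ)
  -- Only the constant `v` must be removed: the logarithm series has index-zero term `x / 0 = 0`.
  have h3 := (h1.sub h2).sub (hasSum_ite_eq 0 (v : ℂ))
  convert! h3 using 1
  · funext j
    rcases eq_or_ne j 0 with rfl | hj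
    · simp [shiftCoeff]
    · simp only [shiftCoeff, hj, if_false]
      push_cast
      rw [mul_pow, pow_succ]
      ring
  · ring

theorem hasSum_cubicCoeff {v : ℝ} (hv0 : 0 ≤ v) (hv1 : v ≤ 1) {y : ℂ} (hy : ‖y‖ < 1) :
    HasSum (fun j => (v : ℂ) * y ^ 2 * ((cubicCoeff v j : ℂ) * y ^ j))
      (v * (Complex.exp y - 1) - Complex.log (1 + v * y) - v * (1 + v) * y ^ 2 / 2) := by
  have hvy : ‖(v : ℂ) * y‖ < 1 := by
    rw [norm_mul, Complex.norm_real, Real.norm_of_nonneg hv0]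
    exact (mul_le_of_le_one_left (norm_nonneg _) hv1).trans_lt hy
  have h1 := (NormedSpace.expSeries_div_hasSum_exp (𝔸 := ℂ) y).mul_left (v : ℂ)
  rw [← Complex.exp_eq_exp_ℂ] at h1
  -- Constant and linear terms of the two series are dropped by the shift of two; the new index `0`
  -- holds the quadratic term, subtracted next.
  have h2 := (hasSum_nat_add_iff' 2).2 (h1.sub (Complex.hasSum_taylorSeries_log hvy))
  have h3 := h2.sub (hasSum_ite_eq 0 ((v : ℂ) * (1 + v) * y ^ 2 / 2))
  convert! h3 using 1
  · funext j
    rcases eq_or_ne j 0 with rfl | hj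
    · simp [cubicCoeff]
      ring
    · simp only [cubicCoeff, hj, if_false]
      push_cast
      rw [mul_pow, pow_succ, pow_succ, pow_succ]
      ring
  · simp [Finset.sum_range_succ]
    ring

/-- Near the saddle point the integrand is a Gaussian times the exponential of a power series. -/
theorem integrand_eq_gaussian_mul_exp {v : ℝ} (hv0 : 0 ≤ v) (hv1 : v ≤ 1) {n N : ℕ} {k : ℤ}
    (hN : (N : ℤ) = n + k) {t : ℝ} (ht : |t| < 1) :
    Complex.exp ((((n : ℝ) + 1) * v : ℝ) * (Complex.exp (t * Complex.I) - 1)) *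
        ((1 + ((v * t : ℝ) : ℂ) * Complex.I) ^ (N + 1))⁻¹ =
      ((Real.exp (-((1 + v) * (n * v) / 2) * t ^ 2) : ℝ) : ℂ) *
        Complex.exp (∑' j, ((shiftCoeff v k j - (n * v * t ^ 2) * cubicCoeff v j : ℝ) : ℂ) *
          ((t : ℂ) * Complex.I) ^ j) := by
  set y : ℂ := (t : ℂ) * Complex.I with hy
  have hyn : ‖y‖ < 1 := by simpa [hy] using ht
  have hy2 : y ^ 2 = -(t : ℂ) ^ 2 := by rw [hy, mul_pow, Complex.I_sq]; ring
  have h1 := hasSum_shiftCoeff hv0 hv1 k hyn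
  have h2 := (hasSum_cubicCoeff hv0 hv1 hyn).mul_left (n : ℂ)
  have h3 := h1.add h2
  have h4 : (fun j => ((shiftCoeff v k j - (n * v * t ^ 2) * cubicCoeff v j : ℝ) : ℂ) * y ^ j) =
      fun j => (shiftCoeff v k j : ℂ) * y ^ j +
        n * (v * y ^ 2 * ((cubicCoeff v j : ℂ) * y ^ j)) := by
    funext j
    rw [hy2]
    push_cast
    ring
  have hne : 1 + (v : ℂ) * y ≠ 0 := by
    have := one_add_mul_I_ne_zero (v * t)
    rw [hy]
    convert! this using 2
    push_cast
    ring
  have h5 : ((1 + ((v * t : ℝ) : ℂ) * Complex.I) ^ (N + 1))⁻¹ =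
      Complex.exp (-((n + 1 + k : ℂ) * Complex.log (1 + v * y))) := by
    have hNc : (n + 1 + k : ℂ) = ((N + 1 : ℕ) : ℂ) := by
      have : (N : ℂ) = n + k := by exact_mod_cast congrArg (Int.cast : ℤ → ℂ) hN
      push_cast
      rw [this]
      ring
    rw [Complex.exp_neg, hNc, Complex.exp_nat_mul, Complex.exp_log hne, hy]
    push_cast
    ring_nf
  rw [h4, h3.tsum_eq, h5, Complex.ofReal_exp, ← Complex.exp_add, ← Complex.exp_add]
  congr 1
  rw [hy2]
  push_cast
  ring

theorem pow_le_of_one_le_mul {t : ℝ} (ht : 1 ≤ 18 * t) {j J : ℕ} (hj : j ≤ J) :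
    9 ^ j * t ^ j ≤ 18 ^ J * t ^ J := by
  rw [← mul_pow, ← mul_pow]
  calc (9 * t) ^ j ≤ (18 * t) ^ j := pow_le_pow_left₀ (by linarith) (by linarith) _
    _ ≤ (18 * t) ^ J := pow_le_pow_right₀ ht hj

/-- One bound covers both regions. Inside the cutoff it is the Taylor remainder; outside, the
integrand is replaced by zero and the Taylor polynomial itself is small compared with `(18 |t|) ^
J`. Hence the polynomial can be integrated over the whole line. -/
theorem norm_truncated_integrand_sub_le {v : ℝ} (hv0 : 0 ≤ v) (hv1 : v ≤ 1) {n N : ℕ} {k : ℤ}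
    (hN : (N : ℤ) = n + k) (J : ℕ) (t : ℝ) :
    ‖(Icc (-(1 / 18 : ℝ)) (1 / 18)).indicator (fun t : ℝ =>
        Complex.exp ((((n : ℝ) + 1) * v : ℝ) * (Complex.exp (t * Complex.I) - 1)) *
          ((1 + ((v * t : ℝ) : ℂ) * Complex.I) ^ (N + 1))⁻¹) t -
      ((Real.exp (-((1 + v) * (n * v) / 2) * t ^ 2) : ℝ) : ℂ) *
        ∑ j ∈ Finset.range J, (((amplitudeCoeff v k j).eval (n * v * t ^ 2) : ℝ) : ℂ) *
          ((t : ℂ) * Complex.I) ^ j‖ ≤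
      Real.exp ((2 + |(k : ℝ)|) / 8) * ((2 + J) * 18 ^ J) *
        (|t| ^ J * Real.exp (-(n * v / 4) * t ^ 2)) := by
  set Λ : ℝ := n * v with hΛ
  have hΛ0 : 0 ≤ Λ := by positivity
  have hw : 0 ≤ Λ * t ^ 2 := by positivity
  set g : ℝ := Real.exp (-((1 + v) * Λ / 2) * t ^ 2) with hg
  have hg0 : 0 < g := Real.exp_pos _
  set B : ℝ := 2 + |(k : ℝ)| with hB
  -- With `w = Λ t²`, this rests on `-(1 + v) w / 2 + w / 8 ≤ -w / 4`.
  have hgle : g * Real.exp ((Λ * t ^ 2 + B) / 8) ≤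
      Real.exp (B / 8) * Real.exp (-(Λ / 4) * t ^ 2) := by
    rw [hg, ← Real.exp_add, ← Real.exp_add]
    apply Real.exp_le_exp.2
    nlinarith [mul_nonneg hv0 hw]
  set e : ℕ → ℂ := fun i => ((shiftCoeff v k i - (Λ * t ^ 2) * cubicCoeff v i : ℝ) : ℂ) with he
  have he0 : e 0 = 0 := by simp [he, shiftCoeff, cubicCoeff]
  have heM : ∀ j, ‖e j‖ ≤ Λ * t ^ 2 + B := norm_phase_le hv0 hv1 hw k
  have hnI : ‖(t : ℂ) * Complex.I‖ = |t| := by simp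
  simp_rw [eval_amplitudeCoeff]
  by_cases ht : t ∈ Icc (-(1 / 18 : ℝ)) (1 / 18)
  · have ht' : |t| ≤ 1 / 18 := abs_le.2 ht
    rw [indicator_of_mem ht, integrand_eq_gaussian_mul_exp hv0 hv1 hN (ht'.trans_lt (by norm_num)),
      ← mul_sub, norm_mul, Complex.norm_real, Real.norm_of_nonneg hg0.le]
    have h1 := norm_exp_tsum_sub_le he0 heM (y := (t : ℂ) * Complex.I) (by rwa [hnI]) J
    rw [hnI] at h1
    have h9 : (2 : ℝ) * 9 ^ J ≤ (2 + J) * 18 ^ J := by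
      have : (9 : ℝ) ^ J ≤ 18 ^ J := pow_le_pow_left₀ (by norm_num) (by norm_num) _
      have hJ : (0 : ℝ) ≤ J := Nat.cast_nonneg J
      have : 0 ≤ (J : ℝ) * 18 ^ J := by positivity
      nlinarith
    calc _ ≤ g * (Real.exp ((Λ * t ^ 2 + B) / 8) * (2 * 9 ^ J) * |t| ^ J) :=
          mul_le_mul_of_nonneg_left h1 hg0.le
      _ = (g * Real.exp ((Λ * t ^ 2 + B) / 8)) * ((2 * 9 ^ J) * |t| ^ J) := by ring
      _ ≤ (Real.exp (B / 8) * Real.exp (-(Λ / 4) * t ^ 2)) * (((2 + J) * 18 ^ J) * |t| ^ J) := by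
          gcongr
      _ = _ := by ring
  · have ht' : 1 ≤ 18 * |t| := by
      by_contra h
      exact ht (abs_le.1 (by linarith))
    rw [indicator_of_notMem ht, zero_sub, norm_neg, norm_mul, Complex.norm_real,
      Real.norm_of_nonneg hg0.le]
    have h1 : ‖∑ j ∈ Finset.range J, expCoeff e j * ((t : ℂ) * Complex.I) ^ j‖ ≤
        ∑ _j ∈ Finset.range J, Real.exp ((Λ * t ^ 2 + B) / 8) * (18 ^ J * |t| ^ J) := by
      refine (norm_sum_le _ _).trans (Finset.sum_le_sum fun j hj => ?_)
      rw [norm_mul, norm_pow, hnI]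
      calc _ ≤ Real.exp ((Λ * t ^ 2 + B) / 8) * 9 ^ j * |t| ^ j :=
            mul_le_mul_of_nonneg_right (norm_expCoeff_le he0 heM j) (by positivity)
        _ = Real.exp ((Λ * t ^ 2 + B) / 8) * (9 ^ j * |t| ^ j) := by ring
        _ ≤ _ := mul_le_mul_of_nonneg_left
            (pow_le_of_one_le_mul ht' (Finset.mem_range.1 hj).le) (Real.exp_pos _).le
    rw [Finset.sum_const, Finset.card_range, nsmul_eq_mul] at h1
    calc _ ≤ g * (J * (Real.exp ((Λ * t ^ 2 + B) / 8) * (18 ^ J * |t| ^ J))) :=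
          mul_le_mul_of_nonneg_left h1 hg0.le
      _ = (g * Real.exp ((Λ * t ^ 2 + B) / 8)) * ((J * 18 ^ J) * |t| ^ J) := by ring
      _ ≤ (Real.exp (B / 8) * Real.exp (-(Λ / 4) * t ^ 2)) * (((2 + J) * 18 ^ J) * |t| ^ J) := by
          gcongr
          linarith
      _ = _ := by ring

end BellAsymptotics

/-! ### Gaussian moments and the uniform Laplace expansion. -/

namespace BellAsymptotics
open Filter Topology Set Polynomial MeasureTheory
open scoped Nat

theorem integrable_pow_mul_gaussian {b : ℝ} (hb : 0 < b) (m : ℕ) :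
    Integrable fun t : ℝ => t ^ m * Real.exp (-b * t ^ 2) := by
  have h := integrable_rpow_mul_exp_neg_mul_sq hb (s := m)
    (by linarith [Nat.cast_nonneg (α := ℝ) m])
  simpa using h

theorem integral_even_pow_mul_gaussian {b : ℝ} (hb : 0 < b) (m : ℕ) :
    ∫ t : ℝ, t ^ (2 * m) * Real.exp (-b * t ^ 2) =
      ((2 * m - 1)‼ : ℕ) / (2 * b) ^ m * Real.sqrt (Real.pi / b) := by
  have h1 : ∫ t : ℝ, t ^ (2 * m) * Real.exp (-b * t ^ 2) =
      ∫ t : ℝ, (fun x : ℝ => x ^ (2 * m) * Real.exp (-b * x ^ 2)) |t| := by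
    refine integral_congr_ae (Eventually.of_forall fun t => ?_)
    simp [pow_mul]
  rw [h1, integral_comp_abs (f := fun x : ℝ => x ^ (2 * m) * Real.exp (-b * x ^ 2))]
  have h2 := integral_rpow_mul_exp_neg_mul_rpow (p := 2) (q := (2 * m : ℕ)) two_pos
    (by linarith [Nat.cast_nonneg (α := ℝ) (2 * m)]) hb
  simp only [Real.rpow_natCast, Real.rpow_two] at h2
  rw [h2]
  have h3 : (((2 * m : ℕ) : ℝ) + 1) / 2 = (m : ℝ) + 1 / 2 := by push_cast; ring
  have h4 : -(((2 * m : ℕ) : ℝ) + 1) / 2 = -((m : ℝ) + 1 / 2) := by push_cast; ring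
  rw [h3, h4, Real.Gamma_nat_add_half, Real.rpow_neg hb.le, Real.rpow_add hb, Real.rpow_natCast,
    ← Real.sqrt_eq_rpow, Real.sqrt_div Real.pi_pos.le, mul_pow]
  have : Real.sqrt b ≠ 0 := (Real.sqrt_pos.2 hb).ne'
  field_simp

theorem integral_odd_pow_mul_gaussian (b : ℝ) (m : ℕ) :
    ∫ t : ℝ, t ^ (2 * m + 1) * Real.exp (-b * t ^ 2) = 0 := by
  have h := integral_neg_eq_self (fun t : ℝ => t ^ (2 * m + 1) * Real.exp (-b * t ^ 2)) volume
  have h2 : ∀ t : ℝ, (-t) ^ (2 * m + 1) * Real.exp (-b * (-t) ^ 2) =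
      -(t ^ (2 * m + 1) * Real.exp (-b * t ^ 2)) := by
    intro t
    rw [Odd.neg_pow ⟨m, rfl⟩, neg_sq, neg_mul]
  simp_rw [h2, integral_neg] at h
  linarith

/-- The coefficient of `Λ⁻ᵐ` in the expansion of the central integral. -/
noncomputable def momentCoeff (v κ : ℝ) (m : ℕ) : ℝ :=
  (-1) ^ m * ∑ p ∈ Finset.range (2 * m + 1),
    (amplitudeCoeff v κ (2 * m)).coeff p * (((2 * (p + m) - 1)‼ : ℕ) / (1 + v) ^ (p + m))

theorem integrable_gaussian_mul_eval_mul_pow {b : ℝ} (hb : 0 < b) (q : ℝ[X]) (Λ : ℝ) (j : ℕ) :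
    Integrable fun t : ℝ => Real.exp (-b * t ^ 2) * (q.eval (Λ * t ^ 2) * t ^ j) := by
  have h : (fun t : ℝ => Real.exp (-b * t ^ 2) * (q.eval (Λ * t ^ 2) * t ^ j)) = fun t =>
      ∑ p ∈ Finset.range (q.natDegree + 1),
        q.coeff p * Λ ^ p * (t ^ (2 * p + j) * Real.exp (-b * t ^ 2)) := by
    funext t
    rw [eval_eq_sum_range, Finset.sum_mul, Finset.mul_sum]
    refine Finset.sum_congr rfl fun p _ => ?_
    rw [mul_pow, ← pow_mul, pow_add]
    ring
  rw [h]
  exact integrable_finsetSum _ fun p _ => (integrable_pow_mul_gaussian hb _).const_mul _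

theorem integral_gaussian_mul_eval_mul_pow {b : ℝ} (hb : 0 < b) {q : ℝ[X]} {d : ℕ}
    (hq : q.natDegree < d) (Λ : ℝ) (j : ℕ) :
    ∫ t : ℝ, Real.exp (-b * t ^ 2) * (q.eval (Λ * t ^ 2) * t ^ j) =
      ∑ p ∈ Finset.range d, q.coeff p * Λ ^ p *
        ∫ t : ℝ, t ^ (2 * p + j) * Real.exp (-b * t ^ 2) := by
  have h : (fun t : ℝ => Real.exp (-b * t ^ 2) * (q.eval (Λ * t ^ 2) * t ^ j)) = fun t =>
      ∑ p ∈ Finset.range d,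
        q.coeff p * Λ ^ p * (t ^ (2 * p + j) * Real.exp (-b * t ^ 2)) := by
    funext t
    rw [eval_eq_sum_range' hq, Finset.sum_mul, Finset.mul_sum]
    refine Finset.sum_congr rfl fun p _ => ?_
    rw [mul_pow, ← pow_mul, pow_add]
    ring
  rw [h, integral_finsetSum _ fun p _ => (integrable_pow_mul_gaussian hb _).const_mul _]
  exact Finset.sum_congr rfl fun p _ => integral_const_mul _ _

/-- Each factor `Λ ^ p` of the polynomial is cancelled by the moment of order `2 (p + m)`, so only
`Λ ^ (-m)` remains. The sign `(-1) ^ m` undoes the one in `momentCoeff`, which stands for `I ^ (2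
m)`. -/
theorem integral_gaussian_mul_amplitude_even {v Λ : ℝ} (hv : 0 ≤ v) (hΛ : 0 < Λ) (κ : ℝ) (m : ℕ) :
    ∫ t : ℝ, Real.exp (-((1 + v) * Λ / 2) * t ^ 2) *
        ((amplitudeCoeff v κ (2 * m)).eval (Λ * t ^ 2) * t ^ (2 * m)) =
      Real.sqrt (2 * Real.pi / ((1 + v) * Λ)) * ((-1) ^ m * (momentCoeff v κ m / Λ ^ m)) := by
  have hv1 : 0 < 1 + v := by linarith
  have hb : 0 < (1 + v) * Λ / 2 := by positivity
  rw [integral_gaussian_mul_eval_mul_pow hb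
    (Nat.lt_succ_of_le (natDegree_amplitudeCoeff_le v κ (2 * m))), momentCoeff]
  have h1 : ((-1 : ℝ) ^ m) * (-1) ^ m = 1 := by rw [← mul_pow]; simp
  rw [mul_div_assoc ((-1 : ℝ) ^ m), ← mul_assoc ((-1 : ℝ) ^ m), h1, one_mul, Finset.sum_div,
    Finset.mul_sum]
  refine Finset.sum_congr rfl fun p _ => ?_
  rw [show 2 * p + 2 * m = 2 * (p + m) by ring, integral_even_pow_mul_gaussian hb,
    show Real.pi / ((1 + v) * Λ / 2) = 2 * Real.pi / ((1 + v) * Λ) by field_simp,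
    show 2 * ((1 + v) * Λ / 2) = (1 + v) * Λ by ring, mul_pow]
  field_simp
  ring

theorem integral_gaussian_mul_amplitude_odd {v Λ : ℝ} (hv : 0 ≤ v) (hΛ : 0 < Λ) (κ : ℝ) (m : ℕ) :
    ∫ t : ℝ, Real.exp (-((1 + v) * Λ / 2) * t ^ 2) *
        ((amplitudeCoeff v κ (2 * m + 1)).eval (Λ * t ^ 2) * t ^ (2 * m + 1)) = 0 := by
  have hb : 0 < (1 + v) * Λ / 2 := by positivity
  rw [integral_gaussian_mul_eval_mul_pow hb (Nat.lt_succ_self _)]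
  refine Finset.sum_eq_zero fun p _ => ?_
  rw [show 2 * p + (2 * m + 1) = 2 * (p + m) + 1 by ring, integral_odd_pow_mul_gaussian, mul_zero]

theorem gaussian_mul_sum_amplitude_eq (v κ Λ b : ℝ) (J : ℕ) :
    (fun t : ℝ => ((Real.exp (-b * t ^ 2) : ℝ) : ℂ) *
        ∑ j ∈ Finset.range J, (((amplitudeCoeff v κ j).eval (Λ * t ^ 2) : ℝ) : ℂ) *
          ((t : ℂ) * Complex.I) ^ j) = fun t : ℝ => ∑ j ∈ Finset.range J, Complex.I ^ j *
        ((Real.exp (-b * t ^ 2) * ((amplitudeCoeff v κ j).eval (Λ * t ^ 2) * t ^ j) : ℝ) : ℂ) := by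
  funext t
  rw [Finset.mul_sum]
  refine Finset.sum_congr rfl fun j _ => ?_
  rw [mul_pow]
  push_cast
  ring

theorem integrable_gaussian_mul_sum_amplitude {b : ℝ} (hb : 0 < b) (v κ Λ : ℝ) (J : ℕ) :
    Integrable fun t : ℝ => ((Real.exp (-b * t ^ 2) : ℝ) : ℂ) *
        ∑ j ∈ Finset.range J, (((amplitudeCoeff v κ j).eval (Λ * t ^ 2) : ℝ) : ℂ) *
          ((t : ℂ) * Complex.I) ^ j := by
  rw [gaussian_mul_sum_amplitude_eq]
  exact integrable_finsetSum _ fun j _ =>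
    (integrable_gaussian_mul_eval_mul_pow hb _ Λ j).ofReal.const_mul _

/-- Odd orders integrate to zero, so `2 M` Taylor terms produce `M` powers of `1 / Λ`. -/
theorem integral_gaussian_mul_sum_amplitude {v Λ : ℝ} (hv : 0 ≤ v) (hΛ : 0 < Λ) (κ : ℝ) (M : ℕ) :
    ∫ t : ℝ, ((Real.exp (-((1 + v) * Λ / 2) * t ^ 2) : ℝ) : ℂ) *
        ∑ j ∈ Finset.range (2 * M), (((amplitudeCoeff v κ j).eval (Λ * t ^ 2) : ℝ) : ℂ) *
          ((t : ℂ) * Complex.I) ^ j =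
      ((Real.sqrt (2 * Real.pi / ((1 + v) * Λ)) *
        ∑ m ∈ Finset.range M, momentCoeff v κ m / Λ ^ m : ℝ) : ℂ) := by
  have hb : 0 < (1 + v) * Λ / 2 := by positivity
  rw [gaussian_mul_sum_amplitude_eq, integral_finsetSum _ fun j _ =>
    (integrable_gaussian_mul_eval_mul_pow hb _ Λ j).ofReal.const_mul _]
  simp_rw [integral_const_mul, integral_complex_ofReal]
  induction M with
  | zero => simp
  | succ M ih =>
    rw [show 2 * (M + 1) = 2 * M + 1 + 1 by ring, Finset.sum_range_succ, Finset.sum_range_succ, ih,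
      integral_gaussian_mul_amplitude_even hv hΛ, integral_gaussian_mul_amplitude_odd hv hΛ,
      Finset.sum_range_succ, pow_mul, Complex.I_sq]
    have h1 : ((-1 : ℂ) ^ M) * (-1) ^ M = 1 := by rw [← mul_pow]; simp
    push_cast
    rw [mul_add]
    linear_combination ((Real.sqrt (2 * Real.pi / ((1 + v) * Λ)) : ℂ) *
      (momentCoeff v κ M / Λ ^ M)) * h1

theorem norm_exp_mul_cexp_sub_one_le {a : ℝ} (ha : 0 ≤ a) (t : ℝ) :
    ‖Complex.exp (a * (Complex.exp (t * Complex.I) - 1))‖ ≤ 1 := by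
  rw [Complex.norm_exp, Real.exp_le_one_iff, Complex.re_ofReal_mul, Complex.sub_re,
    Complex.exp_ofReal_mul_I_re, Complex.one_re]
  nlinarith [Real.cos_le_one t]

theorem integrable_integrand {a v : ℝ} (ha : 0 ≤ a) (hv : v ≠ 0) {N : ℕ} (hN : 1 ≤ N) :
    Integrable fun t : ℝ => Complex.exp (a * (Complex.exp (t * Complex.I) - 1)) *
        ((1 + ((v * t : ℝ) : ℂ) * Complex.I) ^ (N + 1))⁻¹ :=
  (integrable_inv_line_pow hv hN).bdd_mul (c := 1)
    (Continuous.aestronglyMeasurable (by fun_prop))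
    (Eventually.of_forall (norm_exp_mul_cexp_sub_one_le ha))

/-- Away from the saddle point the integrand is negligible. -/
theorem norm_integral_tail_le {a v c : ℝ} (ha : 0 ≤ a) (hv : 0 < v) (hc : 0 ≤ c) {N L : ℕ}
    (hL : 2 * L + 1 ≤ N) :
    ‖∫ t in (Icc (-c) c)ᶜ, Complex.exp (a * (Complex.exp (t * Complex.I) - 1)) *
        ((1 + ((v * t : ℝ) : ℂ) * Complex.I) ^ (N + 1))⁻¹‖ ≤
      ((1 + (v * c) ^ 2) ^ L)⁻¹ * (Real.pi / v) := by
  have hint : ∫ t : ℝ, (1 + (v * t) ^ 2)⁻¹ = Real.pi / v := by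
    have := Measure.integral_comp_mul_left (fun t : ℝ => (1 + t ^ 2)⁻¹) v
    rw [this, integral_univ_inv_one_add_sq, abs_of_pos (inv_pos.2 hv), smul_eq_mul]
    ring
  have hbase := (integrable_inv_one_add_mul_sq hv.ne').const_mul ((1 + (v * c) ^ 2) ^ L)⁻¹
  rw [← hint, ← integral_const_mul]
  refine (norm_integral_le_of_norm_le hbase.integrableOn ?_).trans
    (setIntegral_le_integral hbase (Eventually.of_forall fun t => by positivity))
  filter_upwards [ae_restrict_mem measurableSet_Icc.compl] with t ht
  have htc : c ≤ |t| := by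
    by_contra h
    exact ht (abs_le.1 (not_le.1 h).le)
  rw [norm_mul]
  refine (mul_le_of_le_one_left (norm_nonneg _) (norm_exp_mul_cexp_sub_one_le ha t)).trans ?_
  rw [norm_inv, norm_pow, ← mul_inv]
  refine inv_anti₀ (by positivity) ?_
  have hct : (v * c) ^ 2 ≤ (v * t) ^ 2 := by
    rw [mul_pow, mul_pow, ← sq_abs t]
    gcongr
  -- Of the `2 L + 2` available factors, `2 L` give the decay at the cutoff and two are kept for
  -- integrability.
  calc (1 + (v * c) ^ 2) ^ L * (1 + (v * t) ^ 2)
      ≤ (1 + (v * t) ^ 2) ^ L * (1 + (v * t) ^ 2) := by gcongr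
    _ = ‖1 + ((v * t : ℝ) : ℂ) * Complex.I‖ ^ (2 * L + 2) := by
        rw [← norm_one_add_mul_I_sq]
        ring
    _ ≤ _ := pow_le_pow_right₀ (norm_one_add_mul_I_ge _) (by omega)

/-- Laplace expansion of the line integral, uniformly in `v`. -/
theorem exists_norm_integral_sub_le (k : ℤ) (M : ℕ) :
    ∃ K : ℝ, ∀ (v : ℝ) (n N L : ℕ), 0 < v → v ≤ 1 → 1 ≤ n → (N : ℤ) = n + k → 2 * L + 1 ≤ N →
      ‖(∫ t : ℝ, Complex.exp ((((n : ℝ) + 1) * v : ℝ) * (Complex.exp (t * Complex.I) - 1)) *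
          ((1 + ((v * t : ℝ) : ℂ) * Complex.I) ^ (N + 1))⁻¹) -
        ((Real.sqrt (2 * Real.pi / ((1 + v) * (n * v))) *
          ∑ m ∈ Finset.range M, momentCoeff v k m / (n * v) ^ m : ℝ) : ℂ)‖ ≤
      K * ((n * v) ^ M)⁻¹ * Real.sqrt (2 * Real.pi / ((1 + v) * (n * v))) +
        ((1 + (v * (1 / 18)) ^ 2) ^ L)⁻¹ * (Real.pi / v) := by
  set A : ℝ := Real.exp ((2 + |(k : ℝ)|) / 8) * ((2 + (2 * M : ℕ)) * 18 ^ (2 * M)) with hA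
  refine ⟨A * ((((2 * M - 1)‼ : ℕ) : ℝ) * 2 ^ M * 2), ?_⟩
  intro v n N L hv0 hv1 hn hN hL
  have hn0 : (0 : ℝ) < n := by exact_mod_cast hn
  set Λ : ℝ := n * v with hΛ
  have hΛ0 : 0 < Λ := by positivity
  have hb : 0 < (1 + v) * Λ / 2 := by positivity
  have hb4 : 0 < Λ / 4 := by positivity
  have ha : 0 ≤ ((n : ℝ) + 1) * v := by positivity
  set f : ℝ → ℂ := fun t : ℝ =>
    Complex.exp ((((n : ℝ) + 1) * v : ℝ) * (Complex.exp (t * Complex.I) - 1)) *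
          ((1 + ((v * t : ℝ) : ℂ) * Complex.I) ^ (N + 1))⁻¹ with hf
  have hfint : Integrable f := integrable_integrand ha hv0.ne' (by omega)
  set s : Set ℝ := Icc (-(1 / 18 : ℝ)) (1 / 18) with hs
  have hsplit : ∫ t, f t = (∫ t, s.indicator f t) + ∫ t in sᶜ, f t := by
    rw [integral_indicator measurableSet_Icc, integral_add_compl measurableSet_Icc hfint]
  have htail : ‖∫ t in sᶜ, f t‖ ≤ _ := norm_integral_tail_le ha hv0 (c := 1 / 18) (by norm_num) hL
  have hGint := integrable_gaussian_mul_sum_amplitude hb v k Λ (2 * M)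
  have hpt : ∀ t : ℝ, _ ≤ _ :=
    norm_truncated_integrand_sub_le hv0.le hv1 hN (2 * M)
  have hEint : Integrable fun t : ℝ =>
      A * (|t| ^ (2 * M) * Real.exp (-(Λ / 4) * t ^ 2)) := by
    simp_rw [pow_mul, sq_abs, ← pow_mul]
    exact (integrable_pow_mul_gaussian hb4 _).const_mul _
  have hmain := norm_integral_le_of_norm_le hEint (Eventually.of_forall hpt)
  rw [integral_sub (hfint.indicator measurableSet_Icc) hGint,
    integral_gaussian_mul_sum_amplitude hv0.le hΛ0] at hmain
  have hE : ∫ t : ℝ, A * (|t| ^ (2 * M) * Real.exp (-(Λ / 4) * t ^ 2)) ≤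
      A * ((((2 * M - 1)‼ : ℕ) : ℝ) * 2 ^ M * 2) * (Λ ^ M)⁻¹ *
        Real.sqrt (2 * Real.pi / ((1 + v) * Λ)) := by
    rw [integral_const_mul]
    simp_rw [pow_mul, sq_abs, ← pow_mul]
    rw [integral_even_pow_mul_gaussian hb4]
    -- The error Gaussian is wider than the main one; since `v ≤ 1` its mass exceeds the main mass
    -- by at most a factor `2`.
    have h1 : Real.sqrt (Real.pi / (Λ / 4)) ≤ 2 * Real.sqrt (2 * Real.pi / ((1 + v) * Λ)) := by
      rw [Real.sqrt_le_left (by positivity), mul_pow, Real.sq_sqrt (by positivity)]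
      rw [show Real.pi / (Λ / 4) = 4 * (Real.pi / Λ) by field_simp,
        show 2 * Real.pi / ((1 + v) * Λ) = (2 / (1 + v)) * (Real.pi / Λ) by field_simp]
      have h2 : 1 ≤ 2 / (1 + v) := by
        rw [le_div_iff₀ (by linarith)]
        linarith
      have h3 : 0 ≤ Real.pi / Λ := by positivity
      nlinarith
    have h5 : (2 * (Λ / 4)) ^ M = Λ ^ M / 2 ^ M := by rw [← div_pow]; ring_nf
    rw [h5]
    calc A * ((((2 * M - 1)‼ : ℕ) : ℝ) / (Λ ^ M / 2 ^ M) * Real.sqrt (Real.pi / (Λ / 4)))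
        ≤ A * ((((2 * M - 1)‼ : ℕ) : ℝ) / (Λ ^ M / 2 ^ M) *
            (2 * Real.sqrt (2 * Real.pi / ((1 + v) * Λ)))) := by gcongr
      _ = _ := by field_simp
  rw [hsplit, add_sub_right_comm]
  exact (norm_add_le _ _).trans (add_le_add (hmain.trans hE) htail)

end BellAsymptotics

/-! ### Growth of `α_n` and the calculus of asymptotic series in `α_n / n`. -/

namespace BellAsymptotics
open Filter Topology Set Asymptotics

theorem alpha_pos (n : ℕ) : 0 < alpha n := (alpha_spec n).1

theorem exp_alpha (n : ℕ) : Real.exp (alpha n) = ((n : ℝ) + 1) / alpha n := by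
  rw [eq_div_iff (alpha_pos n).ne', mul_comm, (alpha_spec n).2]

theorem exp_neg_alpha (n : ℕ) : Real.exp (-alpha n) = alpha n / ((n : ℝ) + 1) := by
  rw [Real.exp_neg, exp_alpha, inv_div]

theorem tendsto_alpha : Tendsto alpha atTop atTop := by
  refine tendsto_atTop.2 fun b => ?_
  filter_upwards [tendsto_natCast_atTop_atTop.eventually_ge_atTop (max b 0 * Real.exp (max b 0))]
    with n hn
  by_contra h
  have h1 : alpha n < max b 0 := lt_max_of_lt_left (not_le.1 h)
  have h2 := mul_lt_mul'' h1 (Real.exp_lt_exp.2 h1) (alpha_pos n).le (Real.exp_pos _).le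
  rw [(alpha_spec n).2] at h2
  linarith

theorem eventually_one_le_alpha : ∀ᶠ n in atTop, 1 ≤ alpha n :=
  tendsto_alpha.eventually_ge_atTop 1

theorem eventually_alpha_pow_three_le : ∀ᶠ n : ℕ in atTop, alpha n ^ 3 ≤ n := by
  have h := (Real.isLittleO_pow_exp_atTop (n := 3)).comp_tendsto tendsto_alpha
  filter_upwards [h.bound one_pos, tendsto_alpha.eventually_ge_atTop 2] with n hn h2
  have h3 : alpha n ^ 3 ≤ Real.exp (alpha n) := by
    have h0 := alpha_pos n
    simpa [abs_of_pos h0] using hn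
  have h4 := (alpha_spec n).2
  have h5 : (8 : ℝ) ≤ alpha n ^ 3 := by
    calc (8 : ℝ) = 2 ^ 3 := by norm_num
      _ ≤ _ := pow_le_pow_left₀ (by norm_num) h2 3
  have h6 : 2 * alpha n ^ 3 ≤ alpha n * Real.exp (alpha n) :=
    mul_le_mul h2 h3 (by positivity) (by linarith)
  linarith

theorem tendsto_alpha_div : Tendsto (fun n : ℕ => alpha n / (n : ℝ)) atTop (𝓝 0) := by
  have h0 : Tendsto (fun n => (alpha n)⁻¹) atTop (𝓝 0) := tendsto_alpha.inv_tendsto_atTop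
  refine squeeze_zero' (Eventually.of_forall fun n => by
    have := alpha_pos n
    positivity) ?_ h0
  filter_upwards [eventually_alpha_pow_three_le, eventually_one_le_alpha, eventually_ge_atTop 1]
    with n h3 h1 hn
  have hn0 : (0 : ℝ) < n := by exact_mod_cast hn
  rw [div_le_iff₀ hn0, inv_mul_eq_div, le_div_iff₀ (by linarith)]
  nlinarith [sq_nonneg (alpha n)]

/-- `F n = ∑ₘ cₘ(αₙ) n⁻ᵐ` as an asymptotic series in powers of `αₙ / n`. -/
def HasExpansion (F : ℕ → ℝ) (c : ℕ → ℝ → ℝ) : Prop :=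
  ∀ T : ℕ, (fun n : ℕ => F n - ∑ m ∈ Finset.range T, c m (alpha n) / (n : ℝ) ^ m)
    =O[atTop] fun n : ℕ => (alpha n / (n : ℝ)) ^ T

/-- A single term is the difference of two consecutive remainders, so no separate bound on
coefficients is needed. -/
theorem HasExpansion.isBigO_coeff {F : ℕ → ℝ} {c : ℕ → ℝ → ℝ} (h : HasExpansion F c) (m : ℕ) :
    (fun n : ℕ => c m (alpha n) / (n : ℝ) ^ m) =O[atTop] fun n : ℕ => (alpha n / (n : ℝ)) ^ m := by
  have h1 : (fun n : ℕ => (alpha n / (n : ℝ)) ^ (m + 1)) =O[atTop]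
      fun n : ℕ => (alpha n / (n : ℝ)) ^ m := by
    have := (isBigO_refl (fun n : ℕ => (alpha n / (n : ℝ)) ^ m) atTop).mul
      (tendsto_alpha_div.isBigO_one ℝ)
    simpa [pow_succ] using this
  refine ((h m).sub ((h (m + 1)).trans h1)).congr_left fun n => ?_
  rw [Finset.sum_range_succ]
  ring

/-- With `A` the truncation of `F`, write `F G` as `(F - A) G + A G` and truncate `G` after `T - i`
terms against the `i`-th term of `A`; every error then has order `T`. -/
theorem HasExpansion.mul {F G : ℕ → ℝ} {a b : ℕ → ℝ → ℝ} (hF : HasExpansion F a)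
    (hG : HasExpansion G b) :
    HasExpansion (fun n => F n * G n)
      (fun m u => ∑ i ∈ Finset.range (m + 1), a i u * b (m - i) u) := by
  intro T
  have hG1 : G =O[atTop] fun _ => (1 : ℝ) := by simpa using hG 0
  have h1 := (hF T).mul hG1
  simp only [mul_one] at h1
  have h2 : (fun n : ℕ => ∑ i ∈ Finset.range T, a i (alpha n) / (n : ℝ) ^ i *
      (G n - ∑ j ∈ Finset.range (T - i), b j (alpha n) / (n : ℝ) ^ j)) =O[atTop]
      fun n : ℕ => (alpha n / (n : ℝ)) ^ T := by
    refine IsBigO.fun_sum fun i hi => ?_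
    refine ((hF.isBigO_coeff i).mul (hG (T - i))).congr_right fun n => ?_
    rw [← pow_add, Nat.add_sub_cancel' (Finset.mem_range.1 hi).le]
  refine (h1.add h2).congr_left fun n => ?_
  have h3 : ∑ m ∈ Finset.range T,
      (∑ i ∈ Finset.range (m + 1), a i (alpha n) * b (m - i) (alpha n)) / (n : ℝ) ^ m =
      ∑ i ∈ Finset.range T, ∑ j ∈ Finset.range (T - i),
        a i (alpha n) / (n : ℝ) ^ i * (b j (alpha n) / (n : ℝ) ^ j) := by
    rw [← Finset.sum_range_diag_flip]
    refine Finset.sum_congr rfl fun m _ => ?_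
    rw [Finset.sum_div]
    refine Finset.sum_congr rfl fun i hi => ?_
    rw [div_mul_div_comm, ← pow_add, Nat.add_sub_cancel' (Finset.mem_range_succ_iff.1 hi)]
  rw [h3]
  simp only [mul_sub, Finset.sum_sub_distrib, Finset.mul_sum, sub_mul, Finset.sum_mul]
  ring

theorem hasExpansion_one_add_rpow {κ : ℝ → ℝ} {C : ℝ} (hκ : ∀ u, 0 < u → |κ u| ≤ C) (a : ℝ) :
    HasExpansion (fun n : ℕ => (1 + κ (alpha n) / (n : ℝ)) ^ a)
      (fun m u => Ring.choose a m * κ u ^ m) := by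
  intro T
  have hb : (fun n : ℕ => κ (alpha n) / (n : ℝ)) =O[atTop] fun n : ℕ => alpha n / (n : ℝ) := by
    refine IsBigO.of_bound C ?_
    filter_upwards [eventually_one_le_alpha] with n hn
    have h1 := hκ _ (alpha_pos n)
    have hC : 0 ≤ C := (abs_nonneg _).trans h1
    rw [norm_div, norm_div, ← mul_div_assoc, Real.norm_eq_abs, Real.norm_of_nonneg (alpha_pos n).le]
    gcongr
    nlinarith
  have ht := hb.trans_tendsto tendsto_alpha_div
  have h := ((Real.one_add_rpow_hasFPowerSeriesAt_zero (a := a)).isBigO_sub_partialSum_pow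
    T).comp_tendsto ht
  refine (h.trans ((hb.norm_left.pow T))).congr_left fun n => ?_
  simp [FormalMultilinearSeries.partialSum, binomialSeries, div_pow, mul_div_assoc]
  refine Finset.sum_congr rfl fun m _ => ?_
  ring

/-- On `[0, 1]` one has `exp (x / 2) ≤ 1 + x`, and an exponential dominates each term of its series.
-/
theorem inv_one_add_pow_le (P : ℕ) {x : ℝ} (hx0 : 0 ≤ x) (hx1 : x ≤ 1) {L : ℕ} (hL : 0 < L * x) :
    ((1 + x) ^ L)⁻¹ ≤ P.factorial * (2 / (L * x)) ^ P := by
  have h1 : Real.exp (x / 2) ≤ 1 + x := by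
    have h2 := Real.one_sub_le_exp_neg (x / 2)
    rw [Real.exp_neg] at h2
    have h3 := Real.exp_pos (x / 2)
    have h4 : (1 - x / 2) * Real.exp (x / 2) ≤ 1 := by
      calc _ ≤ (Real.exp (x / 2))⁻¹ * Real.exp (x / 2) := mul_le_mul_of_nonneg_right h2 h3.le
        _ = 1 := inv_mul_cancel₀ h3.ne'
    nlinarith
  have h5 := Real.pow_div_factorial_le_exp (L * x / 2) (by positivity) P
  have h6 : Real.exp (L * x / 2) ≤ (1 + x) ^ L := by
    calc Real.exp (L * x / 2) = Real.exp (x / 2) ^ L := by rw [← Real.exp_nat_mul]; ring_nf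
      _ ≤ _ := pow_le_pow_left₀ (Real.exp_pos _).le h1 _
  have h7 : 0 < (L * x / 2) ^ P / (P.factorial : ℝ) := by positivity
  calc ((1 + x) ^ L)⁻¹ ≤ ((L * x / 2) ^ P / (P.factorial : ℝ))⁻¹ := inv_anti₀ h7 (h5.trans h6)
    _ = _ := by
      rw [inv_div, div_pow, div_pow, mul_div_assoc']
      field_simp

/-- The tail is exponentially small in about `n / α_n²`, hence smaller than any power of `α_n² / n`.
From `α_n³ ≤ n` follows `(α_n² / n)² ≤ α_n / n`, so `P = 2 (M + 2)` yields `M + 2` powers of `α_n /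
n`, two of which pay for the factor `n`. -/
theorem isBigO_tail (M : ℕ) :
    (fun n : ℕ => (n : ℝ) * ((1 + ((alpha n)⁻¹ * (1 / 18)) ^ 2) ^ (n / 4))⁻¹) =O[atTop]
      fun n : ℕ => (alpha n / (n : ℝ)) ^ M := by
  set P : ℕ := 2 * (M + 2) with hP
  refine IsBigO.of_bound (P.factorial * (2 * 8 * 18 ^ 2) ^ P) ?_
  filter_upwards [eventually_alpha_pow_three_le, eventually_one_le_alpha, eventually_ge_atTop 8]
    with n h3 h1 hn
  set r := alpha n with hr
  have hr0 : 0 < r := alpha_pos n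
  have hn0 : (0 : ℝ) < n := by exact_mod_cast (by omega : 0 < n)
  have hx1 : (r⁻¹ * (1 / 18)) ^ 2 ≤ 1 := by
    apply pow_le_one₀ (by positivity)
    have := inv_le_one_of_one_le₀ h1
    nlinarith
  have hL : (n : ℝ) / 8 ≤ ((n / 4 : ℕ) : ℝ) := by
    have : n ≤ 8 * (n / 4) := by omega
    have : (n : ℝ) ≤ 8 * ((n / 4 : ℕ) : ℝ) := by exact_mod_cast this
    linarith
  have hL0 : (0 : ℝ) < ((n / 4 : ℕ) : ℝ) := by linarith
  have hkey := inv_one_add_pow_le P (by positivity) hx1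
    (show 0 < ((n / 4 : ℕ) : ℝ) * (r⁻¹ * (1 / 18)) ^ 2 by positivity)
  have hq : 2 / (((n / 4 : ℕ) : ℝ) * (r⁻¹ * (1 / 18)) ^ 2) ≤ (2 * 8 * 18 ^ 2) * (r ^ 2 / n) := by
    calc 2 / (((n / 4 : ℕ) : ℝ) * (r⁻¹ * (1 / 18)) ^ 2)
        ≤ 2 / ((n : ℝ) / 8 * (r⁻¹ * (1 / 18)) ^ 2) := by gcongr
      _ = _ := by field_simp
  have hr3 : r ^ 4 / (n : ℝ) ^ 2 ≤ r / n := by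
    rw [div_le_div_iff₀ (by positivity) hn0]
    nlinarith [mul_le_mul_of_nonneg_left h3 (by positivity : 0 ≤ r * n)]
  have hr2 : r ^ 2 / (n : ℝ) ≤ 1 := by
    rw [div_le_one hn0]
    nlinarith [sq_nonneg r]
  have hpow : (n : ℝ) * (r ^ 2 / n) ^ P ≤ (r / n) ^ M := by
    calc (n : ℝ) * (r ^ 2 / n) ^ P = n * (r ^ 4 / (n : ℝ) ^ 2) ^ (M + 2) := by
          rw [hP, pow_mul, div_pow]
          ring_nf
      _ ≤ n * (r / n) ^ (M + 2) := by gcongr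
      _ = (r ^ 2 / n) * (r / n) ^ M := by
          rw [pow_add]
          field_simp
      _ ≤ 1 * (r / n) ^ M := by gcongr
      _ = _ := one_mul _
  rw [Real.norm_of_nonneg (by positivity), Real.norm_of_nonneg (by positivity)]
  calc (n : ℝ) * ((1 + (r⁻¹ * (1 / 18)) ^ 2) ^ (n / 4))⁻¹
      ≤ n * (P.factorial * ((2 * 8 * 18 ^ 2) * (r ^ 2 / n)) ^ P) := by
        gcongr
        exact hkey.trans (by gcongr)
    _ = P.factorial * (2 * 8 * 18 ^ 2) ^ P * (n * (r ^ 2 / n) ^ P) := by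
        rw [mul_pow]
        ring
    _ ≤ _ := by gcongr

end BellAsymptotics

/-! ### The expansion of the Bell numbers relative to the main term. -/

namespace BellAsymptotics
open Filter Topology Set Asymptotics

/-- `ζ_{n,k} = ζ⁰ (1 + κ(αₙ)/n)`, where `ζ⁰ = n (αₙ + 1) / αₙ²`. -/
noncomputable def zetaShift (k : ℤ) (u : ℝ) : ℝ := 1 + k * (u + 1)⁻¹

theorem abs_zetaShift_le (k : ℤ) {u : ℝ} (hu : 0 < u) : |zetaShift k u| ≤ 1 + |(k : ℝ)| := by
  unfold zetaShift
  refine (abs_add_le _ _).trans ?_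
  rw [abs_one, abs_mul, abs_of_pos (inv_pos.2 (by linarith : 0 < u + 1))]
  have := inv_le_one_of_one_le₀ (by linarith : 1 ≤ u + 1)
  have := mul_le_of_le_one_right (abs_nonneg (k : ℝ)) this
  linarith

/-- The first two factors are the Gaussian width of the line integral. In `zetaShift`, the summand
`1` accounts for `n + 1` against `n`. -/
theorem zeta_eq_mul {n : ℕ} (hn : 1 ≤ n) (k : ℤ) :
    zeta n k = (1 + (alpha n)⁻¹) * (n * (alpha n)⁻¹) * (1 + zetaShift k (alpha n) / n) := by
  have h0 := alpha_pos n
  have hn0 : (n : ℝ) ≠ 0 := by exact_mod_cast (by omega : n ≠ 0)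
  unfold zeta zetaShift
  rw [exp_alpha]
  field_simp
  ring

theorem zeta_eq_div (n : ℕ) (k : ℤ) :
    zeta n k = (((n : ℝ) + 1) * (alpha n + 1) + (k : ℝ)) / alpha n ^ 2 := by
  have h0 := alpha_pos n
  unfold zeta
  rw [exp_alpha]
  field_simp

theorem eventually_zetaShift_pos (k : ℤ) :
    ∀ᶠ n : ℕ in atTop, 0 < 1 + zetaShift k (alpha n) / n := by
  filter_upwards [tendsto_natCast_atTop_atTop.eventually_gt_atTop (1 + |(k : ℝ)|)] with n hn
  have h1 := abs_zetaShift_le k (alpha_pos n)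
  have hn0 : (0 : ℝ) < n := by linarith [abs_nonneg (k : ℝ)]
  have h2 : -1 < zetaShift k (alpha n) / n := by
    rw [lt_div_iff₀ hn0]
    linarith [neg_abs_le (zetaShift k (alpha n))]
  linarith

/-- The line integral for the Bell number, divided by the leading Gaussian integral. -/
noncomputable def centralRatio (k : ℤ) (n : ℕ) : ℝ :=
  2 * Real.pi * Real.exp 1 * alpha n ^ (((n : ℤ) + k).toNat + 1) *
      Real.exp (-Real.exp (alpha n)) / shiftedFactorial n k * shiftedBell n k /
    Real.sqrt (2 * Real.pi / ((1 + (alpha n)⁻¹) * (n * (alpha n)⁻¹)))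

theorem hasExpansion_centralRatio (k : ℤ) :
    HasExpansion (centralRatio k) (fun m u => momentCoeff u⁻¹ k m * u ^ m) := by
  intro M
  obtain ⟨K, hK⟩ := exists_norm_integral_sub_le k M
  have hb : (fun n : ℕ => K * (alpha n / (n : ℝ)) ^ M + Real.pi *
      ((n : ℝ) * ((1 + ((alpha n)⁻¹ * (1 / 18)) ^ 2) ^ (n / 4))⁻¹)) =O[atTop]
      fun n : ℕ => (alpha n / (n : ℝ)) ^ M :=
    ((isBigO_refl _ _).const_mul_left K).add ((isBigO_tail M).const_mul_left _)
  refine (IsBigO.of_bound 1 ?_).trans hb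
  -- The condition `n ≥ 2 (|k| + 1)` gives `N ≥ n / 2 + 1`, which allows `L = n / 4` in the tail
  -- bound.
  filter_upwards [eventually_one_le_alpha, eventually_alpha_pow_three_le,
    eventually_ge_atTop (2 * (k.natAbs + 1))] with n h1 h3 hn
  set r := alpha n with hr
  have hr0 : 0 < r := alpha_pos n
  have hn1 : 1 ≤ n := by omega
  have hn0 : (0 : ℝ) < n := by exact_mod_cast hn1
  set N : ℕ := ((n : ℤ) + k).toNat with hN
  have hNk : (N : ℤ) = n + k := by omega
  have hv0 : 0 < r⁻¹ := inv_pos.2 hr0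
  have hv1 : r⁻¹ ≤ 1 := inv_le_one_of_one_le₀ h1
  have hrn : r ≤ n := by nlinarith [sq_nonneg r, mul_nonneg hr0.le (sub_nonneg.2 h1)]
  have hΛ1 : 1 ≤ n * r⁻¹ := by
    rw [← div_eq_mul_inv, one_le_div hr0]
    exact hrn
  have hbound := hK r⁻¹ n N (n / 4) hv0 hv1 hn1 hNk (by omega)
  -- The defining equation of `α_n`: this choice of abscissa cancels the linear term of the phase.
  have hexp : ((n : ℝ) + 1) * r⁻¹ = Real.exp r := by rw [hr, exp_alpha, div_eq_mul_inv]
  rw [hexp, bell_eq_line_integral (by omega) hr0, ← Complex.ofReal_sub, Complex.norm_real] at hbound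
  set Λ : ℝ := n * r⁻¹ with hΛ
  have hΛ0 : 0 < Λ := by positivity
  set g : ℝ := Real.sqrt (2 * Real.pi / ((1 + r⁻¹) * Λ)) with hg
  have hg0 : 0 < g := Real.sqrt_pos.2 (by positivity)
  -- A crude bound suffices: together with `π / r⁻¹` it costs a factor `π n`, which `isBigO_tail`
  -- absorbs.
  have hgΛ : g⁻¹ ≤ Λ := by
    rw [inv_le_comm₀ hg0 hΛ0, hg]
    apply Real.le_sqrt_of_sq_le
    rw [inv_pow, ← one_div, div_le_div_iff₀ (by positivity) (by positivity)]
    have hpi := Real.pi_gt_three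
    have h2 : (1 + r⁻¹) * Λ ≤ 2 * Λ ^ 2 := by nlinarith
    nlinarith [sq_nonneg Λ]
  set I : ℝ := 2 * Real.pi * Real.exp 1 * r ^ (N + 1) * Real.exp (-Real.exp r) / N.factorial *
    Nat.bell N with hI
  have hD : centralRatio k n = I / g := rfl
  have hsum : ∑ m ∈ Finset.range M, momentCoeff r⁻¹ k m * r ^ m / (n : ℝ) ^ m =
      ∑ m ∈ Finset.range M, momentCoeff r⁻¹ k m / Λ ^ m := by
    refine Finset.sum_congr rfl fun m _ => ?_
    rw [hΛ, mul_pow, inv_pow]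
    field_simp
  have hΛM : (Λ ^ M)⁻¹ = (r / n) ^ M := by
    rw [hΛ, ← inv_pow, mul_inv, inv_inv, div_eq_mul_inv, mul_comm]
  rw [hsum, hD, one_mul]
  have hrw : I / g - ∑ m ∈ Finset.range M, momentCoeff r⁻¹ k m / Λ ^ m =
      (I - g * ∑ m ∈ Finset.range M, momentCoeff r⁻¹ k m / Λ ^ m) * g⁻¹ := by
    field_simp
  rw [hrw, norm_mul, Real.norm_of_nonneg (inv_pos.2 hg0).le]
  refine le_trans ?_ (Real.le_norm_self _)
  calc _ ≤ (K * (Λ ^ M)⁻¹ * g + ((1 + (r⁻¹ * (1 / 18)) ^ 2) ^ (n / 4))⁻¹ * (Real.pi / r⁻¹)) * g⁻¹ :=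
        mul_le_mul_of_nonneg_right hbound (inv_pos.2 hg0).le
    _ = K * (Λ ^ M)⁻¹ + ((1 + (r⁻¹ * (1 / 18)) ^ 2) ^ (n / 4))⁻¹ * (Real.pi / r⁻¹) * g⁻¹ := by
        field_simp
    _ ≤ K * (Λ ^ M)⁻¹ + ((1 + (r⁻¹ * (1 / 18)) ^ 2) ^ (n / 4))⁻¹ * (Real.pi / r⁻¹) * Λ := by
        gcongr
    _ = _ := by
        rw [hΛM, hΛ]
        field_simp

/-- An exact identity: the last factor compensates for `bellMain` using `ζ_{n,k}` where the Gaussian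
integral gives its `k`-independent part. -/
theorem shiftedBell_eq_bellMain_mul (k : ℤ) : ∀ᶠ n : ℕ in atTop,
    (shiftedBell n k : ℝ) = bellMain n k *
      (centralRatio k n * (1 + zetaShift k (alpha n) / n) ^ (1 / 2 : ℝ)) := by
  filter_upwards [eventually_zetaShift_pos k, eventually_ge_atTop (k.natAbs + 1)] with n hz hn
  have hr0 : 0 < alpha n := alpha_pos n
  have hn0 : (0 : ℝ) < n := by exact_mod_cast (by omega : 0 < n)
  set N : ℕ := ((n : ℤ) + k).toNat with hN
  have hNk : (n : ℝ) + (k : ℝ) = N := by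
    have : (N : ℤ) = n + k := by omega
    exact_mod_cast this.symm
  set A : ℝ := (1 + (alpha n)⁻¹) * (n * (alpha n)⁻¹) with hA
  have hA0 : 0 < A := by positivity
  set H : ℝ := 1 + zetaShift k (alpha n) / n with hH
  have hH2 : 0 < H ^ (1 / 2 : ℝ) := Real.rpow_pos_of_pos hz _
  have hsA : 0 < Real.sqrt A := Real.sqrt_pos.2 hA0
  have hs2 : 0 < Real.sqrt (2 * Real.pi) := Real.sqrt_pos.2 (by positivity)
  have hs2' : Real.sqrt (2 * Real.pi) ^ 2 = 2 * Real.pi := Real.sq_sqrt (by positivity)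
  have hzeta : zeta n k ^ (-(1 / 2) : ℝ) = (Real.sqrt A)⁻¹ * (H ^ (1 / 2 : ℝ))⁻¹ := by
    rw [zeta_eq_mul (by omega), Real.mul_rpow hA0.le hz.le, Real.rpow_neg hA0.le,
      Real.rpow_neg hz.le, ← Real.sqrt_eq_rpow]
  have hlog : Real.exp (Real.exp (alpha n) - ((n : ℝ) + (k : ℝ) + 1) * Real.log (alpha n)) =
      Real.exp (Real.exp (alpha n)) * (alpha n ^ (N + 1))⁻¹ := by
    rw [sub_eq_add_neg, Real.exp_add, Real.exp_neg, hNk]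
    have : ((N : ℝ) + 1) * Real.log (alpha n) = ((N + 1 : ℕ) : ℝ) * Real.log (alpha n) := by
      push_cast
      rfl
    rw [this, Real.exp_nat_mul, Real.exp_log hr0]
  have hf : (shiftedFactorial n k : ℝ) ≠ 0 := by
    exact_mod_cast (Nat.factorial_pos _).ne'
  have he1 := (Real.exp_pos 1).ne'
  have he2 := (Real.exp_pos (Real.exp (alpha n))).ne'
  have hD : centralRatio k n = 2 * Real.pi * Real.exp 1 * alpha n ^ (N + 1) *
      Real.exp (-Real.exp (alpha n)) / shiftedFactorial n k * shiftedBell n k /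
      Real.sqrt (2 * Real.pi / A) := rfl
  rw [bellMain, hD, hzeta, hlog, Real.exp_neg, Real.sqrt_div (by positivity)]
  clear_value A H N
  field_simp
  rw [hs2']
  field_simp

/-- The coefficients of the expansion of `B_{n+k}` relative to its main term. -/
noncomputable def bellCoeff (k : ℤ) (m : ℕ) (u : ℝ) : ℝ :=
  ∑ i ∈ Finset.range (m + 1),
    (momentCoeff u⁻¹ k i * u ^ i) * (Ring.choose (1 / 2 : ℝ) (m - i) * zetaShift k u ^ (m - i))

theorem exists_hasExpansion_shiftedBell (k : ℤ) : ∃ F : ℕ → ℝ, HasExpansion F (bellCoeff k) ∧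
    ∀ᶠ n : ℕ in atTop, (shiftedBell n k : ℝ) = bellMain n k * F n := by
  refine ⟨_, ?_, shiftedBell_eq_bellMain_mul k⟩
  have h := (hasExpansion_centralRatio k).mul
    (hasExpansion_one_add_rpow (κ := zetaShift k) (fun _ hu => abs_zetaShift_le k hu) (1 / 2))
  have hc : bellCoeff k = fun m u => ∑ i ∈ Finset.range (m + 1), (momentCoeff u⁻¹ k i * u ^ i) *
      (Ring.choose (1 / 2 : ℝ) (m - i) * zetaShift k u ^ (m - i)) := by
    funext m u
    rw [bellCoeff]
  rw [hc]
  exact h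

end BellAsymptotics

/-! ### Explicit computation of the first two coefficients. -/

namespace BellAsymptotics
open Polynomial
open scoped Nat

theorem expCoeff_two (e : ℕ → ℝ) : expCoeff e 2 = e 2 + e 1 ^ 2 / 2 := by
  simp [expCoeff_succ, expCoeff_zero, Finset.sum_range_succ]
  ring

theorem expCoeff_four (e : ℕ → ℝ) : expCoeff e 4 =
    e 4 + e 1 * e 3 + e 2 ^ 2 / 2 + e 1 ^ 2 * e 2 / 2 + e 1 ^ 4 / 24 := by
  simp [expCoeff_succ, expCoeff_zero, Finset.sum_range_succ]
  ring

theorem eval_amplitudeCoeff_real (v κ w : ℝ) (j : ℕ) : (amplitudeCoeff v κ j).eval w =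
    expCoeff (fun i => shiftCoeff v κ i - w * cubicCoeff v i) j := by
  have h := map_expCoeff (evalRingHom w) (phaseCoeff v κ) j
  simp only [coe_evalRingHom] at h
  rw [amplitudeCoeff, h]
  congr 1
  funext i
  simp [phaseCoeff]
  ring

theorem amplitudeCoeff_two (v κ : ℝ) : amplitudeCoeff v κ 2 =
    C (shiftCoeff v κ 2 + shiftCoeff v κ 1 ^ 2 / 2) +
      C (-cubicCoeff v 2 - shiftCoeff v κ 1 * cubicCoeff v 1) * X +
      C (cubicCoeff v 1 ^ 2 / 2) * X ^ 2 := by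
  refine Polynomial.funext fun w => ?_
  rw [eval_amplitudeCoeff_real, expCoeff_two]
  simp
  ring

theorem amplitudeCoeff_four (v κ : ℝ) : amplitudeCoeff v κ 4 =
    C (shiftCoeff v κ 4 + shiftCoeff v κ 1 * shiftCoeff v κ 3 + shiftCoeff v κ 2 ^ 2 / 2 +
        shiftCoeff v κ 1 ^ 2 * shiftCoeff v κ 2 / 2 + shiftCoeff v κ 1 ^ 4 / 24) +
      C (-cubicCoeff v 4 - shiftCoeff v κ 1 * cubicCoeff v 3 - cubicCoeff v 1 * shiftCoeff v κ 3 -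
        shiftCoeff v κ 2 * cubicCoeff v 2 - shiftCoeff v κ 1 ^ 2 * cubicCoeff v 2 / 2 -
        shiftCoeff v κ 1 * cubicCoeff v 1 * shiftCoeff v κ 2 -
        shiftCoeff v κ 1 ^ 3 * cubicCoeff v 1 / 6) * X +
      C (cubicCoeff v 1 * cubicCoeff v 3 + cubicCoeff v 2 ^ 2 / 2 +
        shiftCoeff v κ 1 * cubicCoeff v 1 * cubicCoeff v 2 +
        cubicCoeff v 1 ^ 2 * shiftCoeff v κ 2 / 2 +
        shiftCoeff v κ 1 ^ 2 * cubicCoeff v 1 ^ 2 / 4) * X ^ 2 +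
      C (-(cubicCoeff v 1 ^ 2 * cubicCoeff v 2) / 2 -
        shiftCoeff v κ 1 * cubicCoeff v 1 ^ 3 / 6) * X ^ 3 +
      C (cubicCoeff v 1 ^ 4 / 24) * X ^ 4 := by
  refine Polynomial.funext fun w => ?_
  rw [eval_amplitudeCoeff_real, expCoeff_four]
  simp
  ring

theorem momentCoeff_zero (v κ : ℝ) : momentCoeff v κ 0 = 1 := by
  simp [momentCoeff, amplitudeCoeff, expCoeff_zero]

theorem momentCoeff_one (v κ : ℝ) : momentCoeff v κ 1 =
    -((shiftCoeff v κ 2 + shiftCoeff v κ 1 ^ 2 / 2) * (1 / (1 + v)) +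
      (-cubicCoeff v 2 - shiftCoeff v κ 1 * cubicCoeff v 1) * (3 / (1 + v) ^ 2) +
      cubicCoeff v 1 ^ 2 / 2 * (15 / (1 + v) ^ 3)) := by
  simp [momentCoeff, amplitudeCoeff_two, Finset.sum_range_succ, Nat.doubleFactorial, coeff_X,
    coeff_X_pow, coeff_C, -map_add, -map_sub, -map_mul, -map_pow, -map_neg, -map_div₀]

/-- The constants `3, 15, 105, 945, 10395` are the double factorials of the Gaussian moments of
order `4` to `12`. -/
theorem momentCoeff_two (v κ : ℝ) : momentCoeff v κ 2 =
    (shiftCoeff v κ 4 + shiftCoeff v κ 1 * shiftCoeff v κ 3 + shiftCoeff v κ 2 ^ 2 / 2 +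
        shiftCoeff v κ 1 ^ 2 * shiftCoeff v κ 2 / 2 + shiftCoeff v κ 1 ^ 4 / 24) *
          (3 / (1 + v) ^ 2) +
      (-cubicCoeff v 4 - shiftCoeff v κ 1 * cubicCoeff v 3 - cubicCoeff v 1 * shiftCoeff v κ 3 -
        shiftCoeff v κ 2 * cubicCoeff v 2 - shiftCoeff v κ 1 ^ 2 * cubicCoeff v 2 / 2 -
        shiftCoeff v κ 1 * cubicCoeff v 1 * shiftCoeff v κ 2 -
        shiftCoeff v κ 1 ^ 3 * cubicCoeff v 1 / 6) * (15 / (1 + v) ^ 3) +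
      (cubicCoeff v 1 * cubicCoeff v 3 + cubicCoeff v 2 ^ 2 / 2 +
        shiftCoeff v κ 1 * cubicCoeff v 1 * cubicCoeff v 2 +
        cubicCoeff v 1 ^ 2 * shiftCoeff v κ 2 / 2 +
        shiftCoeff v κ 1 ^ 2 * cubicCoeff v 1 ^ 2 / 4) * (105 / (1 + v) ^ 4) +
      (-(cubicCoeff v 1 ^ 2 * cubicCoeff v 2) / 2 -
        shiftCoeff v κ 1 * cubicCoeff v 1 ^ 3 / 6) * (945 / (1 + v) ^ 5) +
      cubicCoeff v 1 ^ 4 / 24 * (10395 / (1 + v) ^ 6) := by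
  simp [momentCoeff, amplitudeCoeff_four, Finset.sum_range_succ, Nat.doubleFactorial, coeff_X,
    coeff_X_pow, coeff_C, -map_add, -map_sub, -map_mul, -map_pow, -map_neg, -map_div₀]

theorem choose_half_two : Ring.choose (1 / 2 : ℝ) 2 = -1 / 8 := by
  have h := Ring.descPochhammer_eq_factorial_smul_choose (1 / 2 : ℝ) 2
  simp [descPochhammer_succ_right, smeval_mul, smeval_sub, smeval_X] at h
  norm_num at h ⊢
  linarith

theorem bellCoeff_zero (k : ℤ) (u : ℝ) : bellCoeff k 0 u = 1 := by
  simp [bellCoeff, momentCoeff_zero]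

theorem bellCoeff_one (k : ℤ) {u : ℝ} (hu : 0 < u) : bellCoeff k 1 u = R₁ (k : ℝ) u := by
  have h1 : u + 1 ≠ 0 := by positivity
  simp only [bellCoeff, momentCoeff_zero, momentCoeff_one, Finset.sum_range_succ, R₁, zetaShift,
    cubicCoeff, shiftCoeff, Finset.sum_range_zero, Nat.factorial, Ring.choose_one_right,
    Ring.choose_zero_right, Nat.sub_zero, Nat.sub_self, pow_zero, pow_one]
  norm_num
  field_simp
  ring

theorem bellCoeff_two (k : ℤ) {u : ℝ} (hu : 0 < u) : bellCoeff k 2 u = R₂ (k : ℝ) u := by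
  have h1 : u + 1 ≠ 0 := by positivity
  simp only [bellCoeff, momentCoeff_zero, momentCoeff_one, momentCoeff_two, Finset.sum_range_succ,
    R₂, zetaShift, choose_half_two,
    cubicCoeff, shiftCoeff, Finset.sum_range_zero, Nat.factorial, Ring.choose_one_right,
    Ring.choose_zero_right, Nat.sub_zero, Nat.sub_self, pow_zero, pow_one,
    show 2 - 1 = 1 from rfl]
  norm_num
  field_simp
  ring

end BellAsymptotics

/-! ### Rationality of all coefficients. -/

namespace BellAsymptotics
open Polynomial

/-- Functions on the positive reals given by rational functions over `ℚ` without positive poles. -/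
def IsRationalOnPos (h : ℝ → ℝ) : Prop :=
  ∃ P Q : ℚ[X], ∀ u : ℝ, 0 < u → aeval u Q ≠ 0 ∧ h u = aeval u P / aeval u Q

namespace IsRationalOnPos

variable {g h : ℝ → ℝ}

theorem const (q : ℚ) : IsRationalOnPos fun _ => (q : ℝ) :=
  ⟨C q, 1, fun u _ => by simp⟩

theorem id : IsRationalOnPos fun u => u :=
  ⟨X, 1, fun u _ => by simp⟩

theorem congr (hg : IsRationalOnPos g) (hgh : ∀ u, 0 < u → h u = g u) : IsRationalOnPos h := by
  obtain ⟨P, Q, hPQ⟩ := hg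
  exact ⟨P, Q, fun u hu => ⟨(hPQ u hu).1, (hgh u hu).trans (hPQ u hu).2⟩⟩

theorem add (hg : IsRationalOnPos g) (hh : IsRationalOnPos h) :
    IsRationalOnPos fun u => g u + h u := by
  obtain ⟨P, Q, hPQ⟩ := hg
  obtain ⟨P', Q', hPQ'⟩ := hh
  refine ⟨P * Q' + Q * P', Q * Q', fun u hu => ?_⟩
  obtain ⟨h1, h2⟩ := hPQ u hu
  obtain ⟨h1', h2'⟩ := hPQ' u hu
  refine ⟨by rw [map_mul]; exact mul_ne_zero h1 h1', ?_⟩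
  simp only [h2, h2']
  rw [div_add_div _ _ h1 h1']
  simp

theorem mul (hg : IsRationalOnPos g) (hh : IsRationalOnPos h) :
    IsRationalOnPos fun u => g u * h u := by
  obtain ⟨P, Q, hPQ⟩ := hg
  obtain ⟨P', Q', hPQ'⟩ := hh
  refine ⟨P * P', Q * Q', fun u hu => ?_⟩
  obtain ⟨h1, h2⟩ := hPQ u hu
  obtain ⟨h1', h2'⟩ := hPQ' u hu
  refine ⟨by rw [map_mul]; exact mul_ne_zero h1 h1', ?_⟩
  simp only [h2, h2']
  rw [div_mul_div_comm]
  simp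

theorem inv (hg : IsRationalOnPos g) (h0 : ∀ u, 0 < u → g u ≠ 0) :
    IsRationalOnPos fun u => (g u)⁻¹ := by
  obtain ⟨P, Q, hPQ⟩ := hg
  refine ⟨Q, P, fun u hu => ?_⟩
  obtain ⟨h1, h2⟩ := hPQ u hu
  refine ⟨fun hP => h0 u hu (by rw [h2, hP, zero_div]), ?_⟩
  simp only [h2, inv_div]

theorem pow (hg : IsRationalOnPos g) (m : ℕ) : IsRationalOnPos fun u => g u ^ m := by
  induction m with
  | zero => simpa using const 1
  | succ m ih => simpa only [pow_succ] using ih.mul hg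

theorem sum {ι : Type*} (s : Finset ι) {f : ι → ℝ → ℝ} (hf : ∀ i ∈ s, IsRationalOnPos (f i)) :
    IsRationalOnPos fun u => ∑ i ∈ s, f i u := by
  classical
  induction s using Finset.induction_on with
  | empty => simpa using const 0
  | insert i s hi ih =>
    simp only [Finset.sum_insert hi]
    exact (hf i (Finset.mem_insert_self i s)).add
      (ih fun j hj => hf j (Finset.mem_insert_of_mem hj))

theorem inv_id : IsRationalOnPos fun u => u⁻¹ := id.inv fun _ hu => hu.ne'

theorem cubicCoeff (j : ℕ) : IsRationalOnPos fun u => cubicCoeff u⁻¹ j := by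
  unfold BellAsymptotics.cubicCoeff
  split_ifs
  · simpa using const 0
  · refine ((const (1 / ((j + 2).factorial : ℚ))).add
      ((const ((-1) ^ j / ((j : ℚ) + 2))).mul (inv_id.pow (j + 1)))).congr fun u _ => ?_
    push_cast
    ring

theorem shiftCoeff (k : ℤ) (j : ℕ) : IsRationalOnPos fun u => shiftCoeff u⁻¹ k j := by
  unfold BellAsymptotics.shiftCoeff
  split_ifs
  · simpa using const 0
  · refine ((inv_id.mul (const (1 / (j.factorial : ℚ)))).add
      ((const ((-1) ^ j * (1 + k) / (j : ℚ))).mul (inv_id.pow j))).congr fun u _ => ?_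
    push_cast
    ring

/-- Strong induction along the recursion for `expCoeff`, read coefficient by coefficient; since the
phase is linear in `X`, only multiplication by scalars and by `X` occurs. -/
theorem coeff_amplitudeCoeff (k : ℤ) (j p : ℕ) :
    IsRationalOnPos fun u => (amplitudeCoeff u⁻¹ k j).coeff p := by
  induction j using Nat.strong_induction_on generalizing p with
  | _ j ih =>
    rcases j with _ | j
    · simp only [amplitudeCoeff, expCoeff_zero, coeff_one]
      split_ifs
      · simpa using const 1
      · simpa using const 0
    · have hX : ∀ i p, IsRationalOnPos fun u => (X * amplitudeCoeff u⁻¹ k (j - i)).coeff p := by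
        intro i p
        rcases p with _ | p
        · simpa using const 0
        · simp only [coeff_X_mul]
          exact ih _ (by omega) p
      have key : IsRationalOnPos fun u => ((1 / ((j : ℚ) + 1) : ℚ) : ℝ) *
          ∑ i ∈ Finset.range (j + 1), (((i : ℚ) + 1 : ℚ) : ℝ) *
            (BellAsymptotics.shiftCoeff u⁻¹ k (i + 1) * (amplitudeCoeff u⁻¹ k (j - i)).coeff p +
              ((-1 : ℚ) : ℝ) * (BellAsymptotics.cubicCoeff u⁻¹ (i + 1) *
                (X * amplitudeCoeff u⁻¹ k (j - i)).coeff p)) :=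
        (const _).mul (sum _ fun i _ => (const _).mul
          (((shiftCoeff k (i + 1)).mul (ih (j - i) (by omega) p)).add
            ((const _).mul ((cubicCoeff (i + 1)).mul (hX i p)))))
      refine key.congr fun u _ => ?_
      have hq : amplitudeCoeff u⁻¹ k (j + 1) = C ((1 / ((j : ℚ) + 1) : ℚ) : ℝ) *
          ∑ i ∈ Finset.range (j + 1), C (((i : ℚ) + 1 : ℚ) : ℝ) *
            (C (BellAsymptotics.shiftCoeff u⁻¹ k (i + 1)) * amplitudeCoeff u⁻¹ k (j - i) +
              C ((-1 : ℚ) : ℝ) * (C (BellAsymptotics.cubicCoeff u⁻¹ (i + 1)) *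
                (X * amplitudeCoeff u⁻¹ k (j - i)))) := by
        rw [amplitudeCoeff, expCoeff_succ, IsScalarTower.algebraMap_apply ℚ ℝ ℝ[X], algebraMap_eq]
        congr 1
        refine Finset.sum_congr rfl fun i _ => ?_
        have hi : C (((i : ℚ) + 1 : ℚ) : ℝ) = (i : ℝ[X]) + 1 := by simp
        rw [hi, phaseCoeff, ← amplitudeCoeff]
        simp only [Rat.cast_neg, Rat.cast_one, map_neg, map_one]
        ring
      rw [hq]
      simp only [coeff_C_mul, finsetSum_coeff, coeff_add]

theorem momentCoeff (k : ℤ) (m : ℕ) : IsRationalOnPos fun u => momentCoeff u⁻¹ k m := by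
  unfold BellAsymptotics.momentCoeff
  have h1 : IsRationalOnPos fun u => (((1 : ℚ) : ℝ) + u⁻¹)⁻¹ :=
    ((const 1).add inv_id).inv fun u hu => by
      have := inv_pos.2 hu
      push_cast
      positivity
  refine ((const ((-1) ^ m)).mul (sum (Finset.range (2 * m + 1)) fun p _ =>
    (coeff_amplitudeCoeff k (2 * m) p).mul
      ((const (Nat.doubleFactorial (2 * (p + m) - 1) : ℚ)).mul (h1.pow (p + m))))).congr
        fun u _ => ?_
  push_cast
  simp only [div_eq_mul_inv, inv_pow]

theorem zetaShift (k : ℤ) : IsRationalOnPos (zetaShift k) := by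
  have h1 : IsRationalOnPos fun u => (u + ((1 : ℚ) : ℝ))⁻¹ :=
    (id.add (const 1)).inv fun u hu => by
      push_cast
      positivity
  refine ((const 1).add ((const (k : ℚ)).mul h1)).congr fun u _ => ?_
  unfold BellAsymptotics.zetaShift
  push_cast
  rfl

theorem bellCoeff (k : ℤ) (m : ℕ) : IsRationalOnPos (bellCoeff k m) := by
  have hch : ∀ i, Ring.choose (1 / 2 : ℝ) i = ((Ring.choose (1 / 2 : ℚ) i : ℚ) : ℝ) := by
    intro i
    have := Ring.map_choose (algebraMap ℚ ℝ) (1 / 2) i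
    simpa using this.symm
  refine (sum (Finset.range (m + 1)) fun i _ => ((momentCoeff k i).mul (id.pow i)).mul
    ((const (Ring.choose (1 / 2 : ℚ) (m - i))).mul ((zetaShift k).pow (m - i)))).congr
      fun u _ => ?_
  unfold BellAsymptotics.bellCoeff
  simp only [hch]

end IsRationalOnPos

/-- Evaluation uses the reduced fraction. Its denominator divides `Q`, so it does not vanish at `u`
and cross-multiplication applies. -/
theorem ratFunc_eval_div {P Q : ℚ[X]} {u : ℝ} (hQ : aeval u Q ≠ 0) :
    RatFunc.eval (algebraMap ℚ ℝ) u
      (algebraMap ℚ[X] (RatFunc ℚ) P / algebraMap ℚ[X] (RatFunc ℚ) Q) =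
      aeval u P / aeval u Q := by
  have hQ0 : Q ≠ 0 := by
    rintro rfl
    simp at hQ
  set f := algebraMap ℚ[X] (RatFunc ℚ) P / algebraMap ℚ[X] (RatFunc ℚ) Q with hf
  have h1 := congrArg (aeval u) ((RatFunc.num_mul_eq_mul_denom_iff (x := f) hQ0).2 hf)
  have hd : aeval u f.denom ≠ 0 := by
    obtain ⟨S, hS⟩ := RatFunc.denom_div_dvd P Q
    intro h
    apply hQ
    rw [hS, map_mul, h, zero_mul]
  rw [map_mul, map_mul] at h1
  rw [RatFunc.eval, ← aeval_def, ← aeval_def, div_eq_div_iff hd hQ]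
  exact h1

theorem IsRationalOnPos.exists_ratFunc {h : ℝ → ℝ} (hh : IsRationalOnPos h) :
    ∃ f : RatFunc ℚ, ∀ u : ℝ, 0 < u → f.eval (algebraMap ℚ ℝ) u = h u := by
  obtain ⟨P, Q, hPQ⟩ := hh
  exact ⟨_, fun u hu => (ratFunc_eval_div (hPQ u hu).1).trans (hPQ u hu).2.symm⟩

theorem eval_R₁ (k : ℤ) {u : ℝ} (hu : 0 < u) :
    RatFunc.eval (algebraMap ℚ ℝ) u (R₁ (k : RatFunc ℚ) RatFunc.X) = R₁ (k : ℝ) u := by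
  have hQ : aeval u (24 * (X + 1) ^ 3 : ℚ[X]) ≠ 0 := by
    have : (0 : ℝ) < 24 * (u + 1) ^ 3 := by positivity
    simpa [map_ofNat] using this.ne'
  have h := ratFunc_eval_div (P := (-12 * (k : ℚ[X]) ^ 2 + 24 * (k : ℚ[X]) - 2)
    + (-24 * (k : ℚ[X]) ^ 2 + 24 * (k : ℚ[X]) + 18) * X
    + (-12 * (k : ℚ[X]) ^ 2 - 12 * (k : ℚ[X]) + 20) * X ^ 2
    + (-12 * (k : ℚ[X]) + 3) * X ^ 3 - 2 * X ^ 4) hQ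
  simpa [R₁, RatFunc.algebraMap_X, map_ofNat] using h

theorem eval_R₂ (k : ℤ) {u : ℝ} (hu : 0 < u) :
    RatFunc.eval (algebraMap ℚ ℝ) u (R₂ (k : RatFunc ℚ) RatFunc.X) = R₂ (k : ℝ) u := by
  have hQ : aeval u (1152 * (X + 1) ^ 6 : ℚ[X]) ≠ 0 := by
    have : (0 : ℝ) < 1152 * (u + 1) ^ 6 := by positivity
    simpa [map_ofNat] using this.ne'
  have h := ratFunc_eval_div (P :=
    (144 * (k : ℚ[X]) ^ 4 - 384 * (k : ℚ[X]) ^ 3 + 624 * (k : ℚ[X]) ^ 2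
      - 1152 * (k : ℚ[X]) + 100)
    + (576 * (k : ℚ[X]) ^ 4 - 576 * (k : ℚ[X]) ^ 3 + 816 * (k : ℚ[X]) ^ 2
      - 3264 * (k : ℚ[X]) - 648) * X
    + (864 * (k : ℚ[X]) ^ 4 + 1056 * (k : ℚ[X]) ^ 3 + 432 * (k : ℚ[X]) ^ 2
      - 6384 * (k : ℚ[X]) - 1292) * X ^ 2
    + (576 * (k : ℚ[X]) ^ 4 + 2784 * (k : ℚ[X]) ^ 3 + 2280 * (k : ℚ[X]) ^ 2
      - 7440 * (k : ℚ[X]) - 2604) * X ^ 3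
    + (144 * (k : ℚ[X]) ^ 4 + 2016 * (k : ℚ[X]) ^ 3 + 3888 * (k : ℚ[X]) ^ 2
      - 3552 * (k : ℚ[X]) - 2988) * X ^ 4
    + (480 * (k : ℚ[X]) ^ 3 + 2328 * (k : ℚ[X]) ^ 2 + 72 * (k : ℚ[X]) - 1800) * X ^ 5
    + (480 * (k : ℚ[X]) ^ 2 + 600 * (k : ℚ[X]) - 551) * X ^ 6
    + (144 * (k : ℚ[X]) - 60) * X ^ 7 + 4 * X ^ 8) hQ
  simpa [R₂, RatFunc.algebraMap_X, map_ofNat] using h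

/-- The rational functions in the expansion are independent of its length. -/
theorem exists_ratFunc_coeff : ∃ R : ℕ → ℤ → RatFunc ℚ,
    (∀ k : ℤ, R 1 k = R₁ (k : RatFunc ℚ) RatFunc.X) ∧
    (∀ k : ℤ, R 2 k = R₂ (k : RatFunc ℚ) RatFunc.X) ∧
    ∀ (m : ℕ) (k : ℤ) (u : ℝ), 0 < u → (R m k).eval (algebraMap ℚ ℝ) u = bellCoeff k m u := by
  choose S hS using fun (m : ℕ) (k : ℤ) => (IsRationalOnPos.bellCoeff k m).exists_ratFunc
  -- The indices `1` and `2` are overridden so that the explicit formulas hold as identities of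
  -- rational functions.
  refine ⟨fun m k => if m = 1 then R₁ (k : RatFunc ℚ) RatFunc.X else
    if m = 2 then R₂ (k : RatFunc ℚ) RatFunc.X else S m k, fun k => by simp, fun k => by simp,
    fun m k u hu => ?_⟩
  dsimp only
  split_ifs with h1 h2
  · rw [h1, eval_R₁ k hu, bellCoeff_one k hu]
  · rw [h2, eval_R₂ k hu, bellCoeff_two k hu]
  · exact hS m k u hu

end BellAsymptotics

/-! ### Quotients of Bell numbers. -/

namespace BellAsymptotics
open Filter Topology Asymptotics

theorem inv_natCast_isBigO_exp_neg_alpha :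
    (fun n : ℕ => ((n : ℝ))⁻¹) =O[atTop] fun n : ℕ => Real.exp (-alpha n) := by
  refine IsBigO.of_bound 2 ?_
  filter_upwards [eventually_one_le_alpha, eventually_ge_atTop 1] with n h1 hn
  have hn1 : (1 : ℝ) ≤ n := by exact_mod_cast hn
  rw [exp_neg_alpha, Real.norm_of_nonneg (by positivity),
    Real.norm_of_nonneg (div_nonneg (by linarith) (by linarith)), inv_eq_one_div,
    ← mul_div_assoc, div_le_div_iff₀ (by linarith) (by linarith)]
  nlinarith

theorem alpha_div_isBigO_exp_neg_alpha :
    (fun n : ℕ => alpha n / (n : ℝ)) =O[atTop] fun n : ℕ => Real.exp (-alpha n) := by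
  refine IsBigO.of_bound 2 ?_
  filter_upwards [eventually_ge_atTop 1] with n hn
  have hn1 : (1 : ℝ) ≤ n := by exact_mod_cast hn
  have h0 := alpha_pos n
  rw [exp_neg_alpha, Real.norm_of_nonneg (by positivity), Real.norm_of_nonneg (by positivity),
    ← mul_div_assoc, div_le_div_iff₀ (by linarith) (by linarith)]
  nlinarith

theorem tendsto_exp_neg_alpha : Tendsto (fun n => Real.exp (-alpha n)) atTop (𝓝 0) :=
  Real.tendsto_exp_neg_atTop_nhds_zero.comp tendsto_alpha

/-- `F n = 1 + O(exp (-αₙ))`. -/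
def NearOne (F : ℕ → ℝ) : Prop :=
  (fun n => F n - 1) =O[atTop] fun n : ℕ => Real.exp (-alpha n)

namespace NearOne

variable {F G : ℕ → ℝ}

theorem tendsto (hF : NearOne F) : Tendsto F atTop (𝓝 1) :=
  tendsto_sub_nhds_zero_iff.1 (IsBigO.trans_tendsto hF tendsto_exp_neg_alpha)

theorem mul (hF : NearOne F) (hG : NearOne G) : NearOne fun n => F n * G n := by
  have h1 := IsBigO.mul hF (hG.tendsto.isBigO_one ℝ)
  simp only [mul_one] at h1
  refine (h1.add hG).congr_left fun n => ?_
  ring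

theorem comp (hF : NearOne F) {f : ℝ → ℝ} (hf : DifferentiableAt ℝ f 1) (hf1 : f 1 = 1) :
    NearOne fun n => f (F n) := by
  have h := (hf.isBigO_sub.comp_tendsto hF.tendsto).trans hF
  refine h.congr_left fun n => ?_
  simp [hf1]

theorem rpow (hF : NearOne F) (a : ℝ) : NearOne fun n => F n ^ a :=
  hF.comp (f := fun x => x ^ a) (Real.differentiableAt_rpow_const_of_ne a one_ne_zero)
    (Real.one_rpow a)

theorem inv (hF : NearOne F) : NearOne fun n => (F n)⁻¹ :=
  hF.comp (f := fun x => x⁻¹) (differentiableAt_inv one_ne_zero) inv_one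

theorem one_add_div_natCast {κ : ℕ → ℝ} {C : ℝ} (hκ : ∀ n, |κ n| ≤ C) :
    NearOne fun n => 1 + κ n / (n : ℝ) := by
  refine IsBigO.trans (IsBigO.of_bound C ?_) inv_natCast_isBigO_exp_neg_alpha
  refine Eventually.of_forall fun n => ?_
  rw [add_sub_cancel_left, div_eq_mul_inv, norm_mul]
  exact mul_le_mul_of_nonneg_right (hκ n) (norm_nonneg _)

end NearOne

theorem HasExpansion.nearOne {F : ℕ → ℝ} {k : ℤ} (hF : HasExpansion F (bellCoeff k)) :
    NearOne F := by
  refine IsBigO.trans ((hF 1).congr (fun n => ?_) fun n => pow_one _)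
    alpha_div_isBigO_exp_neg_alpha
  simp [bellCoeff_zero]

/-- The last parenthesis does not depend on `k` and cancels in the quotient by the case `k = 0`. -/
theorem bellMain_eq (k : ℤ) : ∀ᶠ n : ℕ in atTop, bellMain n k =
    (shiftedFactorial n k : ℝ) * alpha n ^ (-k) *
      (1 + zetaShift k (alpha n) / n) ^ (-(1 / 2) : ℝ) *
      ((((1 + (alpha n)⁻¹) * (n * (alpha n)⁻¹)) ^ (-(1 / 2) : ℝ)) *
        Real.exp (Real.exp (alpha n) - ((n : ℝ) + 1) * Real.log (alpha n)) /
          (Real.sqrt (2 * Real.pi) * Real.exp 1)) := by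
  filter_upwards [eventually_zetaShift_pos k, eventually_ge_atTop 1] with n hz hn
  have hr0 : 0 < alpha n := alpha_pos n
  have hA0 : 0 < (1 + (alpha n)⁻¹) * (n * (alpha n)⁻¹) := by
    have : (0 : ℝ) < n := by exact_mod_cast hn
    positivity
  have hexp : Real.exp (Real.exp (alpha n) - ((n : ℝ) + (k : ℝ) + 1) * Real.log (alpha n)) =
      Real.exp (Real.exp (alpha n) - ((n : ℝ) + 1) * Real.log (alpha n)) * alpha n ^ (-k) := by
    rw [← Real.rpow_intCast, Real.rpow_def_of_pos hr0, ← Real.exp_add]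
    congr 1
    push_cast
    ring
  rw [bellMain, hexp, zeta_eq_mul hn, Real.mul_rpow hA0.le hz.le]
  ring

theorem shiftedBell_zero (n : ℕ) : shiftedBell n 0 = Nat.bell n := by
  simp [shiftedBell]

theorem shiftedFactorial_zero (n : ℕ) : shiftedFactorial n 0 = Nat.factorial n := by
  simp [shiftedFactorial]

theorem exists_nearOne_bell_ratio (k : ℤ) : ∃ E : ℕ → ℝ, NearOne E ∧ ∀ᶠ n : ℕ in atTop,
    (shiftedBell n k : ℝ) / (Nat.bell n : ℝ) =
      (shiftedFactorial n k : ℝ) / (Nat.factorial n : ℝ) * alpha n ^ (-k) * E n := by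
  obtain ⟨F, hF, hFeq⟩ := exists_hasExpansion_shiftedBell k
  obtain ⟨G, hG, hGeq⟩ := exists_hasExpansion_shiftedBell 0
  have hH : ∀ k : ℤ, NearOne fun n => 1 + zetaShift k (alpha n) / (n : ℝ) := fun k =>
    NearOne.one_add_div_natCast fun n => abs_zetaShift_le k (alpha_pos n)
  refine ⟨_, (hF.nearOne.mul hG.nearOne.inv).mul
    (((hH k).rpow (-(1 / 2))).mul ((hH 0).rpow (-(1 / 2))).inv), ?_⟩
  filter_upwards [hFeq, hGeq, bellMain_eq k, bellMain_eq 0, eventually_zetaShift_pos 0,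
    eventually_ge_atTop 1] with n h1 h2 h3 h4 hz hn
  have hr0 : 0 < alpha n := alpha_pos n
  have hn0 : (0 : ℝ) < n := by exact_mod_cast hn
  rw [shiftedBell_zero] at h2
  rw [shiftedFactorial_zero] at h4
  rw [h1, h2, h3, h4]
  have hc : (((1 + (alpha n)⁻¹) * (n * (alpha n)⁻¹)) ^ (-(1 / 2) : ℝ)) *
        Real.exp (Real.exp (alpha n) - ((n : ℝ) + 1) * Real.log (alpha n)) /
          (Real.sqrt (2 * Real.pi) * Real.exp 1) ≠ 0 := by positivity
  have hf : (Nat.factorial n : ℝ) ≠ 0 := by positivity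
  have hz' : (1 + zetaShift 0 (alpha n) / (n : ℝ)) ^ (-(1 / 2) : ℝ) ≠ 0 :=
    (Real.rpow_pos_of_pos hz _).ne'
  generalize (((1 + (alpha n)⁻¹) * (n * (alpha n)⁻¹)) ^ (-(1 / 2) : ℝ)) *
        Real.exp (Real.exp (alpha n) - ((n : ℝ) + 1) * Real.log (alpha n)) /
          (Real.sqrt (2 * Real.pi) * Real.exp 1) = c at hc ⊢
  generalize (1 + zetaShift 0 (alpha n) / (n : ℝ)) ^ (-(1 / 2) : ℝ) = z at hz' ⊢
  generalize (1 + zetaShift k (alpha n) / (n : ℝ)) ^ (-(1 / 2) : ℝ) = w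
  simp only [neg_zero, zpow_zero, mul_one]
  -- Inverses of products split even at zero, so only the common factor `c` has to be nonzero for
  -- the cancellation.
  rw [div_eq_mul_inv, div_eq_mul_inv]
  simp only [mul_inv]
  have e1 := mul_inv_cancel₀ hc
  linear_combination (shiftedFactorial n k * alpha n ^ (-k) * w * F n *
    (n.factorial : ℝ)⁻¹ * z⁻¹ * (G n)⁻¹) * e1

/-- The correction term is a bounded quantity over `n`. Hence its power `-1 / 2` can be inserted
into the quotient formula at the cost of another factor `1 + O(e ^ (-α_n))`. -/
theorem nearOne_shift_correction (k : ℤ) : NearOne fun n =>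
    1 - (k : ℝ) * alpha n / (((n : ℝ) + 1) * (alpha n + 1)) := by
  have h := NearOne.one_add_div_natCast (C := |(k : ℝ)|)
    (κ := fun n => -(k * (alpha n / (alpha n + 1) * ((n : ℝ) / (n + 1))))) fun n => by
      have h0 := alpha_pos n
      rw [abs_neg, abs_mul]
      refine mul_le_of_le_one_right (abs_nonneg _) ?_
      rw [abs_of_nonneg (by positivity)]
      exact mul_le_one₀ ((div_le_one (by linarith)).2 (by linarith)) (by positivity)
        ((div_le_one (by positivity)).2 (by linarith))
  refine IsBigO.congr' h ?_ EventuallyEq.rfl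
  filter_upwards [eventually_ge_atTop 1] with n hn
  have h0 := alpha_pos n
  have hn0 : (n : ℝ) ≠ 0 := by exact_mod_cast (by omega : n ≠ 0)
  field_simp
  ring

theorem sum_range_bellCoeff_div_pow (k : ℤ) (u x : ℝ) (T : ℕ) :
    ∑ m ∈ Finset.range (T + 1), bellCoeff k m u / x ^ m =
      1 + ∑ m ∈ Finset.Icc 1 T, bellCoeff k m u * (1 / x ^ m) := by
  induction T with
  | zero => simp [bellCoeff_zero]
  | succ T ih =>
    rw [Finset.sum_range_succ, ih, Finset.sum_Icc_succ_top (by omega)]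
    ring

end BellAsymptotics

theorem proposition5 :
    (∀ (n : ℕ) (k : ℤ),
      BellAsymptotics.zeta n k =
        (((n : ℝ) + 1) * (BellAsymptotics.alpha n + 1) + (k : ℝ)) / BellAsymptotics.alpha n ^ 2) ∧
    (∀ k : ℤ, ∃ ε : ℕ → ℝ,
      ε =O[Filter.atTop] (fun n : ℕ => Real.exp (-BellAsymptotics.alpha n)) ∧
      ∀ᶠ n : ℕ in Filter.atTop,
        (BellAsymptotics.shiftedBell n k : ℝ) = BellAsymptotics.bellMain n k * (1 + ε n)) ∧
    (∃ R : ℕ → ℤ → RatFunc ℚ,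
      (∀ k : ℤ, R 1 k = BellAsymptotics.R₁ (k : RatFunc ℚ) RatFunc.X) ∧
      (∀ k : ℤ, R 2 k = BellAsymptotics.R₂ (k : RatFunc ℚ) RatFunc.X) ∧
      ∀ (k : ℤ) (T : ℕ), ∃ ε : ℕ → ℝ,
        ε =O[Filter.atTop] (fun n : ℕ => (BellAsymptotics.alpha n / (n : ℝ)) ^ (T + 1)) ∧
        ∀ᶠ n : ℕ in Filter.atTop,
          (BellAsymptotics.shiftedBell n k : ℝ) =
            BellAsymptotics.bellMain n k *
              (1 + ∑ m ∈ Finset.Icc 1 T,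
                  (R m k).eval (algebraMap ℚ ℝ) (BellAsymptotics.alpha n) * (1 / (n : ℝ) ^ m)
                + ε n)) ∧
    (∀ k : ℤ, ∃ ε : ℕ → ℝ,
      ε =O[Filter.atTop] (fun n : ℕ => Real.exp (-BellAsymptotics.alpha n)) ∧
      ∀ᶠ n : ℕ in Filter.atTop,
        (BellAsymptotics.shiftedBell n k : ℝ) / (Nat.bell n : ℝ) =
          (BellAsymptotics.shiftedFactorial n k : ℝ) / (Nat.factorial n : ℝ) *
            BellAsymptotics.alpha n ^ (-k) * (1 + ε n)) ∧
    (∀ k : ℤ, ∃ ε : ℕ → ℝ,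
      ε =O[Filter.atTop] (fun n : ℕ => Real.exp (-BellAsymptotics.alpha n)) ∧
      ∀ᶠ n : ℕ in Filter.atTop,
        (BellAsymptotics.shiftedBell n k : ℝ) / (Nat.bell n : ℝ) =
          (BellAsymptotics.shiftedFactorial n k : ℝ) / (Nat.factorial n : ℝ) *
            BellAsymptotics.alpha n ^ (-k) *
            (1 - (k : ℝ) * BellAsymptotics.alpha n /
              (((n : ℝ) + 1) * (BellAsymptotics.alpha n + 1))) ^ (-(1 / 2) : ℝ) *
            (1 + ε n)) := by
  open BellAsymptotics in
  refine ⟨zeta_eq_div, fun k => ?_, ?_, fun k => ?_, fun k => ?_⟩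
  · obtain ⟨F, hF, hFeq⟩ := exists_hasExpansion_shiftedBell k
    exact ⟨fun n => F n - 1, hF.nearOne, by simpa using hFeq⟩
  · obtain ⟨R, h1, h2, hR⟩ := exists_ratFunc_coeff
    refine ⟨R, h1, h2, fun k T => ?_⟩
    obtain ⟨F, hF, hFeq⟩ := exists_hasExpansion_shiftedBell k
    -- Truncating at `T + 1` keeps the indices `0` to `T`; index `0` contributes the leading `1`.
    refine ⟨_, hF (T + 1), ?_⟩
    filter_upwards [hFeq] with n hn
    rw [hn, sum_range_bellCoeff_div_pow]
    simp only [hR _ _ _ (alpha_pos n)]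
    ring
  · obtain ⟨E, hE, hEeq⟩ := exists_nearOne_bell_ratio k
    exact ⟨fun n => E n - 1, hE, by simpa using hEeq⟩
  · obtain ⟨E, hE, hEeq⟩ := exists_nearOne_bell_ratio k
    have hS := nearOne_shift_correction k
    refine ⟨_, hE.mul (hS.rpow (-(1 / 2))).inv, ?_⟩
    filter_upwards [hEeq, hS.tendsto.eventually (lt_mem_nhds one_pos)] with n hn hpos
    have h0 := (Real.rpow_pos_of_pos hpos (-(1 / 2))).ne'
    rw [hn, add_sub_cancel]
    generalize (1 - (k : ℝ) * alpha n / (((n : ℝ) + 1) * (alpha n + 1))) ^ (-(1 / 2) : ℝ) = z at h0 ⊢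
    field_simp
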